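/- For $n\ge 1$ let $\tau_n(X)=\mathbb E\big(\tfrac1n\operatorname{Tr}X\big)$ for a random $n\times n$ complex matrix $X$. A complex random variable is called complex $N(0,\sigma^2)$ if its real and imaginary parts are independent real Gaussian variables with mean $0$ and variance $\sigma^2/2$. Write $T_n\in\mathrm{UTGRM}(n,\frac1n)$ if the entries $t_{ij}$ of the random $n\times n$ matrix $T_n$ vanish for $i\ge j$ and $(t_{ij})_{1\le i<j\le n}$ is an independent family of complex $N(0,\frac1n)$ variables. A pairing $\sigma$ of $\{1,\dots,k\}$ is a partition into two-element blocks. It is crossing if $i_1<i_2<j_1<j_2$ for some blocks $\{i_1,j_1\},\{i_2,j_2\}\in\sigma$, and non-crossing otherwise. It is compatible with $\varepsilon\in\{1,*\}^k$ if $\varepsilon(i)\ne\varepsilon(j)$ for every $\{i,j\}\in\sigma$. Let $NCP_\varepsilon(k)$ be the set of non-crossing pairings of $\{1,\dots,k\}$ compatible with $\varepsilon$. For $\sigma\in NCP_\varepsilon(k)$, take the $k$-gon with vertices $v_1,\dots,v_k$ and edges $e_j$ joining $v_j$ and $v_{j+1}$ (indices modulo $k$), where $e_j$ is an arrow to $v_j$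 from $v_{j+1}$ if $\varepsilon(j)=1$, and an arrow to $v_{j+1}$ from $v_j$ if $\varepsilon(j)=*$. Let $Q$ be the oriented quotient graph obtained by gluing $e_i$ to $e_j$ for each $\{i,j\}\in\sigma$, so that $v_i$ is identified with $v_{j+1}$ and $v_{i+1}$ with $v_j$. Let $V(Q)$ be its vertex set. Write $w\leftarrow w'$ if $Q$ has an arrow to $w$ from $w'$, and let $NTO(\sigma;\varepsilon)$ be the number of total orderings $<$ of $V(Q)$ such that $w<w'$ whenever $w\leftarrow w'$. **Theorem.** (a) Let $\mu$ be a compactly supported Borel probability measure on $\mathbb C$. For each $n$ let $D_n$ be a random diagonal $n\times n$ matrix whose diagonal entries are i.i.d. with distribution $\mu$, and let $T_n\in\mathrm{UTGRM}(n,\frac1n)$ be independent of $D_n$ (as matrix-valued random variables). Then the pair $(D_n,T_n)$ converges jointly in $*$-moments: for every word $w$ in four letters, $\tau_n(w(D_n,D_n^*,T_n,T_n^*))$ is well defined and converges as $n\to\infty$, to a limit depending only on $\mu$ and $w$. Moreover, for all $a,b\ge0$, $$\lim_{n\to\infty}\tau_n(D_n^a(D_n^*)^b)=\int\lambda^a\bar\lambda^b\,d\mu(\lambda),$$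 and for all $k\ge1$, $a_j,b_j\ge0$ and $\varepsilon\in\{1,*\}^k$, $$\lim_{n\to\infty}\tau_n\big(D_n^{a_1}(D_n^*)^{b_1}T_n^{\varepsilon(1)}\cdots D_n^{a_k}(D_n^*)^{b_k}T_n^{\varepsilon(k)}\big)=\frac1{(\frac k2+1)!}\sum_{\sigma\in NCP_\varepsilon(k)}\Big(\prod_{w\in V(Q)}\int\lambda^{r(w)}\bar\lambda^{\,s(w)}\,d\mu(\lambda)\Big)NTO(\sigma;\varepsilon),$$ where $r(w)$ and $s(w)$ are the sums of $a_j$, respectively $b_j$, over all $j$ such that $v_j$ is mapped to $w$ (if $k$ is odd, the right-hand side is $0$). (b) For each $n$ let $T_n\in\mathrm{UTGRM}(n,\frac1n)$. For all $k\ge1$ and $\varepsilon\in\{1,*\}^k$, the moment $\tau_n(T_n^{\varepsilon(1)}\cdots T_n^{\varepsilon(k)})$ is well defined and converges as $n\to\infty$. The limit is $0$ if $NCP_\varepsilon(k)=\emptyset$, and in general $$\lim_{n\to\infty}\tau_n(T_n^{\varepsilon(1)}\cdots T_n^{\varepsilon(k)})=\frac1{(\frac k2+1)!}\sum_{\sigma\in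 NCP_\varepsilon(k)}NTO(\sigma;\varepsilon)$$ (if $k$ is odd, the right-hand side is $0$). (c) $NTO(\sigma;\varepsilon)\ge1$ for all $k\ge1$, $\varepsilon\in\{1,*\}^k$ and $\sigma\in NCP_\varepsilon(k)$. -/

import Mathlib

open MeasureTheory ProbabilityTheory Filter Topology
open scoped NNReal ComplexConjugate

namespace DT

/-! ### Star-words and moments of random matrices -/

/-- The two possible exponents `1` and `*` of a letter in a star-word. -/
inductive Expo : Type
  | one : Expo
  | star : Expo

/-- `x ^ 1 = x` and `x ^ * = star x`. -/
def Expo.app {A : Type*} [Star A] : Expo → A → A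
  | Expo.one, x => x
  | Expo.star, x => Star.star x

/-- The word `x_{ι(1)}^{ε(1)} ⋯ x_{ι(m)}^{ε(m)}` in a family `x` and its adjoints;
the empty word is `1`. -/
def starWord {ι A : Type*} [Monoid A] [Star A] (x : ι → A) (w : List (ι × Expo)) : A :=
  (w.map fun p => p.2.app (x p.1)).prod

/-- The normalized trace `tr_n` on `n × n` complex matrices. -/
noncomputable def normTrace {n : ℕ} (A : Matrix (Fin n) (Fin n) ℂ) : ℂ :=
  (n : ℂ)⁻¹ * A.trace

/-- `τ_n(X) = E(tr_n(X))` for a random `n × n` matrix `X`. -/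
noncomputable def tau {n : ℕ} {Ω : Type*} [MeasurableSpace Ω] (P : Measure Ω)
    (X : Ω → Matrix (Fin n) (Fin n) ℂ) : ℂ :=
  ∫ ω, normTrace (X ω) ∂P

/-! ### The random matrices -/

/-- The random variable `a` is complex `N(0, v)`: its real and imaginary parts are independent
real Gaussian random variables with mean `0` and variance `v / 2`. -/
def IsComplexGaussian {Ω : Type*} [MeasurableSpace Ω] (P : Measure Ω) (a : Ω → ℂ) (v : ℝ≥0) :
    Prop :=
  HasLaw (fun ω => (a ω).re) (gaussianReal 0 (v / 2)) P ∧
  HasLaw (fun ω => (a ω).im) (gaussianReal 0 (v / 2)) P ∧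
  IndepFun (fun ω => (a ω).re) (fun ω => (a ω).im) P

/-- `T` is an upper triangular Gaussian random matrix in `UTGRM(n, v)`: the entries on and below
the diagonal vanish, and the entries strictly above the diagonal are independent and complex
`N(0, v)`. -/
structure IsUTGRM {n : ℕ} {Ω : Type*} [MeasurableSpace Ω] (P : Measure Ω)
    (T : Ω → Matrix (Fin n) (Fin n) ℂ) (v : ℝ≥0) : Prop where
  lower_zero : ∀ i j : Fin n, j ≤ i → ∀ᵐ ω ∂P, T ω i j = 0
  gaussian : ∀ i j : Fin n, i < j → IsComplexGaussian P (fun ω => T ω i j) v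
  indep : iIndepFun (fun (p : {p : Fin n × Fin n // p.1 < p.2}) ω => T ω p.1.1 p.1.2) P

/-- `D` is a diagonal random matrix whose diagonal entries are i.i.d. with distribution `μ`. -/
structure IsIIDDiagonal {n : ℕ} {Ω : Type*} [MeasurableSpace Ω] (P : Measure Ω)
    (D : Ω → Matrix (Fin n) (Fin n) ℂ) (μ : Measure ℂ) : Prop where
  off_diag : ∀ i j : Fin n, i ≠ j → ∀ᵐ ω ∂P, D ω i j = 0
  law : ∀ i : Fin n, HasLaw (fun ω => D ω i i) μ P
  indep : iIndepFun (fun (i : Fin n) ω => D ω i i) P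

/-- Independence of two random matrices as matrix-valued random variables. -/
def IndepMatrices {n : ℕ} {Ω : Type*} [MeasurableSpace Ω] (P : Measure Ω)
    (X Y : Ω → Matrix (Fin n) (Fin n) ℂ) : Prop :=
  IndepFun (fun ω (p : Fin n × Fin n) => X ω p.1 p.2) (fun ω (p : Fin n × Fin n) => Y ω p.1 p.2) P

/-! ### Pairings and quotient graphs of the polygon

The `k`-gon has vertices `v_j` and edges `e_j` for `j : Fin k`; the edge `e_j` joins `v_j` to
`v_{j+1}`, where `j + 1 = finRotate k j` is taken cyclically. -/

/-- A pairing of `Fin k`, encoded by the map `σ` sending each point to its partner; the blocks of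
the pairing are the sets `{i, σ i}`. -/
def IsPairing {k : ℕ} (σ : Fin k → Fin k) : Prop :=
  ∀ i, σ i ≠ i ∧ σ (σ i) = i

/-- No two blocks `{i₁, j₁}` and `{i₂, j₂}` satisfy `i₁ < i₂ < j₁ < j₂`. -/
def IsNonCrossing {k : ℕ} (σ : Fin k → Fin k) : Prop :=
  ¬ ∃ i₁ i₂ : Fin k, i₁ < i₂ ∧ i₂ < σ i₁ ∧ σ i₁ < σ i₂

/-- Paired positions carry different exponents. -/
def IsCompatible {k : ℕ} (ε : Fin k → Expo) (σ : Fin k → Fin k) : Prop :=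
  ∀ i, ε i ≠ ε (σ i)

open Classical in
/-- The non-crossing pairings of `Fin k` that are compatible with `ε`. -/
noncomputable def compatibleNCP {k : ℕ} (ε : Fin k → Expo) : Finset (Fin k → Fin k) :=
  Finset.univ.filter fun σ => IsPairing σ ∧ IsNonCrossing σ ∧ IsCompatible ε σ

/-- The equivalence relation on the vertices of the `k`-gon generated by gluing the edges `e_i`
and `e_j`, for each block `{i, j}` of `σ`, in such a way that `v_i` is identified with `v_{j+1}`
and `v_{i+1}` with `v_j`. -/
def vertexSetoid {k : ℕ} (σ : Fin k → Fin k) : Setoid (Fin k) :=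
  Relation.EqvGen.setoid fun x y => ∃ i, x = i ∧ y = finRotate k (σ i)

/-- The vertices of the quotient graph `Q(σ; ε)`. -/
def QVert {k : ℕ} (σ : Fin k → Fin k) : Type :=
  Quotient (vertexSetoid σ)

/-- The image in the quotient graph of the vertex `v_j` of the `k`-gon. -/
def QVert.mk {k : ℕ} (σ : Fin k → Fin k) (j : Fin k) : QVert σ :=
  Quotient.mk (vertexSetoid σ) j

noncomputable instance {k : ℕ} (σ : Fin k → Fin k) : Fintype (QVert σ) :=
  @Quotient.fintype (Fin k) _ (vertexSetoid σ) (Classical.decRel _)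

/-- `arrow ε σ w w'` is the relation `w ← w'`: some edge of the quotient graph is an arrow pointing
to `w` from `w'`.  The edge `e_j` points to `v_j` from `v_{j+1}` if `ε j = 1`, and to `v_{j+1}`
from `v_j` if `ε j = *`. -/
def arrow {k : ℕ} (ε : Fin k → Expo) (σ : Fin k → Fin k) (w w' : QVert σ) : Prop :=
  ∃ j : Fin k,
    (ε j = Expo.one ∧ w = QVert.mk σ j ∧ w' = QVert.mk σ (finRotate k j)) ∨
    (ε j = Expo.star ∧ w = QVert.mk σ (finRotate k j) ∧ w' = QVert.mk σ j)

/-- `NTO(σ; ε)`: the number of strict total orderings of the vertices of the quotient graph that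
extend the relation `←`. -/
noncomputable def NTO {k : ℕ} (ε : Fin k → Expo) (σ : Fin k → Fin k) : ℕ :=
  Nat.card {r : QVert σ → QVert σ → Prop //
    IsStrictTotalOrder (QVert σ) r ∧ ∀ w w', arrow ε σ w w' → r w w'}

/-! ### Limit formulas -/

/-- The limit star-moment
`1 / (k/2 + 1)! * ∑_σ NTO(σ; ε)`.
If `k` is odd, there are no pairings and the sum is empty. -/
noncomputable def limitT {k : ℕ} (ε : Fin k → Expo) : ℂ :=
  (1 / ((k / 2 + 1).factorial : ℂ)) * ∑ σ ∈ compatibleNCP ε, (NTO ε σ : ℂ)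

/-- The moment `M_μ(r, s) = ∫ λ^r conj(λ)^s dμ(λ)`. -/
noncomputable def starMoment (μ : Measure ℂ) (r s : ℕ) : ℂ :=
  ∫ z, z ^ r * (conj z) ^ s ∂μ

open Classical in
/-- The weight `∏_w M_μ(r(w), s(w))` over the vertices `w` of the quotient graph, where `r(w)` and
`s(w)` are the sums of the `a_j` and of the `b_j` over those `j` for which `v_j` is mapped
to `w`. -/
noncomputable def weight (μ : Measure ℂ) {k : ℕ} (a b : Fin k → ℕ) (σ : Fin k → Fin k) : ℂ :=
  ∏ w : QVert σ, starMoment μ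
    (∑ j ∈ Finset.univ.filter (fun j => QVert.mk σ j = w), a j)
    (∑ j ∈ Finset.univ.filter (fun j => QVert.mk σ j = w), b j)

/-- The limit joint star-moment
`1 / (k/2 + 1)! * ∑_σ weight(σ) * NTO(σ; ε)`. -/
noncomputable def limitDT (μ : Measure ℂ) {k : ℕ} (a b : Fin k → ℕ) (ε : Fin k → Expo) : ℂ :=
  (1 / ((k / 2 + 1).factorial : ℂ)) *
    ∑ σ ∈ compatibleNCP ε, weight μ a b σ * (NTO ε σ : ℂ)

/-- The two letters, standing for `D_n` and `T_n`. -/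
inductive Letter : Type
  | D : Letter
  | T : Letter

/-- The pair `(D, T)` as a family indexed by the two letters. -/
def pair {A : Type*} (D T : A) : Letter → A
  | Letter.D => D
  | Letter.T => T

/-- The word `D^a (D^*)^b`. -/
def wordD (a b : ℕ) : List (Letter × Expo) :=
  List.replicate a (Letter.D, Expo.one) ++ List.replicate b (Letter.D, Expo.star)

/-- The word `D^{a_1} (D^*)^{b_1} T^{ε(1)} ⋯ D^{a_k} (D^*)^{b_k} T^{ε(k)}`. -/
def wordDT {k : ℕ} (a b : Fin k → ℕ) (ε : Fin k → Expo) : List (Letter × Expo) :=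
  (List.ofFn fun j => wordD (a j) (b j) ++ [(Letter.T, ε j)]).flatten

/-- The word `T^{ε(1)} ⋯ T^{ε(k)}` in the single letter `T`. -/
def wordT {k : ℕ} (ε : Fin k → Expo) : List (Unit × Expo) :=
  List.ofFn fun j => ((), ε j)

end DT

namespace DT

/-! ### The quotient graph of a pairing -/

section Pairing

variable {k : ℕ} {σ : Fin k → Fin k}

/-! Expand the normalized trace of a word as a sum over closed index walks `i` around the k-gon.
Independence of `D` and `T` splits the expectation of each term. The `D` factor is a product of
moments of μ over the values of `i`. For the `T` factor, `wick_formula` sums over all compatible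
pairings σ, crossing or not. Paired letters use the same matrix entry exactly when `i` is constant
on glued vertices (`entryPos_partner_iff`), and triangularity makes labels increase strictly along
arrows. Hence `tau_word_eq`: with variance 1/n, the moment is n^(-1-k/2) times a sum over σ of
moments of μ, summed over increasing labelings of the quotient graph by `Fin n`.

The asymptotics is then counting. The quotient graph is connected with at most k/2 edges, so it has
at most k/2 + 1 vertices. For non-crossing σ every edge is a bridge and the bound is attained
(`card_QVert_of_nonCrossing`). For crossing σ the second block gives a detour around an edge, so the
bound is missed (`card_QVert_le_of_crossing`) and the contribution is O(1/n). In the non-crossing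
case almost all labelings are injective, and an injective labeling is a total order of the d = k/2 +
1 vertices together with a d-element set of labels. The increasing ones therefore number NTO times
the binomial coefficient of n over d, asymptotically NTO n^d / d! (`tendsto_sum_labelings`), each
weighted by `weight`.

An arbitrary word reduces to block form, or to a word in `D` alone, because `D` almost surely
commutes with its adjoint and the trace is cyclic. The case of `T` alone is `D = 1`, μ = δ_1.
Positivity of NTO comes from a height function on the polygon that changes by one along each edge
and descends to the quotient. -/

lemma val_finRotate (i : Fin k) :
    (finRotate k i : ℕ) = if (i : ℕ) + 1 = k then 0 else (i : ℕ) + 1 := by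
  cases k with
  | zero => exact i.elim0
  | succ n =>
    rw [coe_finRotate]
    simp [Fin.ext_iff]

lemma mk_finRotate_partner (σ : Fin k → Fin k) (j : Fin k) :
    QVert.mk σ (finRotate k (σ j)) = QVert.mk σ j :=
  (Quotient.sound (s := vertexSetoid σ) (Relation.EqvGen.rel _ _ ⟨j, rfl, rfl⟩)).symm

lemma QVert.ind {p : QVert σ → Prop} (h : ∀ j, p (QVert.mk σ j)) (w : QVert σ) : p w :=
  Quotient.ind h w

lemma QVert.mk_surjective (σ : Fin k → Fin k) : Function.Surjective (QVert.mk σ) :=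
  Quotient.mk_surjective

/-- A function on the vertices of the polygon that respects the gluing descends to the
quotient graph. -/
def QVert.lift {α : Type*} (f : Fin k → α) (hf : ∀ j, f j = f (finRotate k (σ j))) :
    QVert σ → α :=
  Quotient.lift f fun x y h => by
    induction h with
    | rel x y h => obtain ⟨i, rfl, rfl⟩ := h; exact hf _
    | refl => rfl
    | symm _ _ _ ih => exact ih.symm
    | trans _ _ _ _ _ h₁ h₂ => exact h₁.trans h₂

@[simp] lemma QVert.lift_mk {α : Type*} (f : Fin k → α) (hf : ∀ j, f j = f (finRotate k (σ j)))
    (j : Fin k) : QVert.lift f hf (QVert.mk σ j) = f j := rfl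

lemma IsPairing.injective (hσ : IsPairing σ) : Function.Injective σ :=
  Function.LeftInverse.injective fun i => (hσ i).2

/-- A block with exactly one end inside the interval of another block would cross it. -/
lemma IsPairing.between (hσ : IsPairing σ) (hn : IsNonCrossing σ) {a l : Fin k}
    (h₁ : a < l) (h₂ : l < σ a) : a < σ l ∧ σ l < σ a := by
  have hl := hσ l
  have ha := hσ a
  have hne : σ l ≠ a := by
    rintro h; rw [← h, hl.2] at h₂; exact lt_irrefl _ h₂
  have hne' : σ l ≠ σ a := fun h => h₁.ne (hσ.injective h).symm
  constructor
  · by_contra hc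
    have hlt : σ l < a := lt_of_le_of_ne (not_lt.1 hc) hne
    exact hn ⟨σ l, a, hlt, by rw [hl.2]; exact h₁, by rw [hl.2]; exact h₂⟩
  · by_contra hc
    have hlt : σ a < σ l := lt_of_le_of_ne (not_lt.1 hc) hne'.symm
    exact hn ⟨a, l, h₁, h₂, hlt⟩

/-! ### Heights and linear extensions -/

/-- The increment of the height function along the edge `e_j`. -/
def Expo.sign : Expo → ℤ
  | Expo.one => 1
  | Expo.star => -1

lemma Expo.sign_of_ne {e e' : Expo} (h : e ≠ e') : e.sign = -e'.sign := by
  cases e <;> cases e' <;> simp_all [Expo.sign]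

/-- The height of the vertex `v_j` of the polygon. -/
def height (ε : Fin k → Expo) (j : Fin k) : ℤ :=
  ∑ l ∈ Finset.univ.filter (· < j), (ε l).sign

/-- Partners have opposite signs, so any σ-stable set cancels in pairs. It is applied to the whole
polygon and to the interior of a block. -/
lemma sum_sign_eq_zero {ε : Fin k → Expo} (hσ : IsPairing σ) (hc : IsCompatible ε σ)
    (s : Finset (Fin k)) (hs : ∀ l ∈ s, σ l ∈ s) : ∑ l ∈ s, (ε l).sign = 0 := by
  refine Finset.sum_involution (fun l _ => σ l) (fun l _ => ?_) (fun l _ _ => (hσ l).1)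
    (fun l hl => hs l hl) (fun l _ => (hσ l).2)
  rw [Expo.sign_of_ne (hc l)]; ring

/-- At the last edge the polygon closes up and the height returns to 0; this is consistent because
all signs together sum to zero. -/
lemma height_finRotate {ε : Fin k → Expo} (hσ : IsPairing σ) (hc : IsCompatible ε σ)
    (j : Fin k) : height ε (finRotate k j) = height ε j + (ε j).sign := by
  have key : height ε j + (ε j).sign
      = ∑ l ∈ Finset.univ.filter (fun l : Fin k => l ≤ j), (ε l).sign := by
    have : Finset.univ.filter (fun l : Fin k => l ≤ j)
        = insert j (Finset.univ.filter (fun l : Fin k => l < j)) := by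
      ext l; simp [le_iff_lt_or_eq, or_comm]
    rw [this, Finset.sum_insert (by simp), height, add_comm]
  rw [key, height]
  have hv := val_finRotate j
  split_ifs at hv with h
  · have h₁ : Finset.univ.filter (fun l : Fin k => l < finRotate k j) = ∅ := by
      ext l
      simp only [Finset.mem_filter, Finset.mem_univ, true_and, Finset.notMem_empty, iff_false,
        Fin.lt_def, hv]
      omega
    have h₂ : Finset.univ.filter (fun l : Fin k => l ≤ j) = Finset.univ := by
      ext l
      simp only [Finset.mem_filter, Finset.mem_univ, true_and, iff_true, Fin.le_def]
      omega
    rw [h₁, h₂, sum_sign_eq_zero hσ hc _ fun _ _ => Finset.mem_univ _, Finset.sum_empty]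
  · refine Finset.sum_congr ?_ fun _ _ => rfl
    ext l
    simp only [Finset.mem_filter, Finset.mem_univ, true_and, Fin.le_def, Fin.lt_def, hv]
    omega

lemma height_partner_of_lt {ε : Fin k → Expo} (hσ : IsPairing σ) (hn : IsNonCrossing σ)
    (hc : IsCompatible ε σ) {j : Fin k} (hj : j < σ j) :
    height ε (σ j) = height ε j + (ε j).sign := by
  have hset : Finset.univ.filter (fun l : Fin k => l < σ j)
      = (Finset.univ.filter (fun l : Fin k => l < j)) ∪
        insert j (Finset.univ.filter (fun l : Fin k => j < l ∧ l < σ j)) := by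
    ext l
    simp only [Finset.mem_filter, Finset.mem_univ, true_and, Finset.mem_union, Finset.mem_insert]
    constructor
    · intro h
      rcases lt_trichotomy l j with h' | h' | h'
      · exact Or.inl h'
      · exact Or.inr (Or.inl h')
      · exact Or.inr (Or.inr ⟨h', h⟩)
    · rintro (h | rfl | h)
      · exact h.trans hj
      · exact hj
      · exact h.2
  have hd : Disjoint (Finset.univ.filter (fun l : Fin k => l < j))
      (insert j (Finset.univ.filter (fun l : Fin k => j < l ∧ l < σ j))) := by
    rw [Finset.disjoint_left]
    intro l
    simp only [Finset.mem_filter, Finset.mem_univ, true_and, Finset.mem_insert]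
    rintro h (rfl | h')
    · exact lt_irrefl _ h
    · exact lt_asymm h h'.1
  rw [height, hset, Finset.sum_union hd, Finset.sum_insert (by simp),
    sum_sign_eq_zero hσ hc (Finset.univ.filter (fun l : Fin k => j < l ∧ l < σ j)) ?_, height,
    add_zero]
  intro l hl
  simp only [Finset.mem_filter, Finset.mem_univ, true_and] at hl ⊢
  exact hσ.between hn hl.1 hl.2

/-- The edge at `σ j` undoes the step made at `j`, and everything between them cancels because no
block leaves that interval. Thus the height is well defined on the quotient graph. -/
lemma height_glue {ε : Fin k → Expo} (hσ : IsPairing σ) (hn : IsNonCrossing σ)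
    (hc : IsCompatible ε σ) (j : Fin k) : height ε j = height ε (finRotate k (σ j)) := by
  rw [height_finRotate hσ hc, ← neg_neg (ε (σ j)).sign, ← Expo.sign_of_ne (hc j)]
  rcases lt_or_gt_of_ne (hσ j).1 with h | h
  · have := height_partner_of_lt hσ hn hc (j := σ j) (by rwa [(hσ j).2])
    rw [(hσ j).2, Expo.sign_of_ne (hc j).symm] at this
    linarith
  · rw [height_partner_of_lt hσ hn hc h]; ring

lemma exists_height {ε : Fin k → Expo} (hσ : IsPairing σ) (hn : IsNonCrossing σ)
    (hc : IsCompatible ε σ) : ∃ H : QVert σ → ℤ, ∀ w w', arrow ε σ w w' → H w < H w' := by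
  refine ⟨QVert.lift (height ε) (height_glue hσ hn hc), ?_⟩
  rintro w w' ⟨j, ⟨h, rfl, rfl⟩ | ⟨h, rfl, rfl⟩⟩ <;>
    · simp only [QVert.lift_mk, height_finRotate hσ hc, h, Expo.sign]
      omega

instance : Finite (QVert σ) := Finite.of_fintype _

theorem NTO_pos {ε : Fin k → Expo} (hσ : IsPairing σ) (hn : IsNonCrossing σ)
    (hc : IsCompatible ε σ) : 1 ≤ NTO ε σ := by
  obtain ⟨H, hH⟩ := exists_height hσ hn hc
  let e := Fintype.equivFin (QVert σ)
  -- Ties in height are broken by an arbitrary enumeration of the vertices.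
  let g : QVert σ → ℤ ×ₗ Fin (Fintype.card (QVert σ)) := fun w => toLex (H w, e w)
  have hg : Function.Injective g := fun w w' h => by
    have : (H w, e w) = (H w', e w') := toLex.injective h
    exact e.injective (Prod.ext_iff.1 this).2
  have : Nonempty {r : QVert σ → QVert σ → Prop //
      IsStrictTotalOrder (QVert σ) r ∧ ∀ w w', arrow ε σ w w' → r w w'} := by
    refine ⟨⟨fun w w' => g w < g w', ?_, ?_⟩⟩
    · exact { irrefl := fun w => lt_irrefl _
              trans := fun _ _ _ => lt_trans
              trichotomous := fun w w' h h' => hg (le_antisymm (not_lt.1 h') (not_lt.1 h)) }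
    · intro w w' h
      exact Prod.Lex.toLex_lt_toLex.2 (Or.inl (hH w w' h))
  exact Nat.card_pos

/-! ### The number of vertices of the quotient graph -/

/-- The edge `e_j` as an unordered pair of vertices of the quotient graph. -/
def qEdge (σ : Fin k → Fin k) (j : Fin k) : Sym2 (QVert σ) :=
  s(QVert.mk σ j, QVert.mk σ (finRotate k j))

/-- The quotient graph, with orientations, loops and multiplicities forgotten. -/
def qGraph (σ : Fin k → Fin k) : SimpleGraph (QVert σ) :=
  SimpleGraph.fromEdgeSet (Set.range (qEdge σ))

lemma qEdge_partner (hσ : IsPairing σ) (j : Fin k) : qEdge σ (σ j) = qEdge σ j := by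
  have h := mk_finRotate_partner σ (σ j)
  rw [(hσ j).2] at h
  rw [qEdge, qEdge, mk_finRotate_partner, ← h, Sym2.eq_swap]

/-- The left endpoints of the blocks of a pairing. -/
def leftEnds (σ : Fin k → Fin k) : Finset (Fin k) :=
  Finset.univ.filter fun j => j < σ j

lemma IsPairing.card_leftEnds (hσ : IsPairing σ) : 2 * (leftEnds σ).card = k := by
  have h : (Finset.univ.filter fun j => ¬ j < σ j) = (leftEnds σ).image σ := by
    ext j
    simp only [Finset.mem_filter, Finset.mem_univ, true_and, Finset.mem_image, leftEnds]
    constructor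
    · intro h
      exact ⟨σ j, by rw [(hσ j).2]; exact lt_of_le_of_ne (not_lt.1 h) (hσ j).1, (hσ j).2⟩
    · rintro ⟨l, hl, rfl⟩
      rw [(hσ l).2]; exact hl.not_gt
  have h₂ := Finset.card_filter_add_card_filter_not (s := (Finset.univ : Finset (Fin k)))
    (fun j => j < σ j)
  rw [h, Finset.card_image_of_injective _ hσ.injective] at h₂
  simp only [Finset.card_univ, Fintype.card_fin] at h₂
  change (leftEnds σ).card + _ = _ at h₂
  omega

lemma IsPairing.exists_leftEnd (hσ : IsPairing σ) (j : Fin k) :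
    ∃ l ∈ leftEnds σ, qEdge σ l = qEdge σ j ∧ (j = l ∨ j = σ l) := by
  rcases lt_or_gt_of_ne (hσ j).1 with h | h
  · exact ⟨σ j, by simpa [leftEnds, (hσ j).2] using h, qEdge_partner hσ j, Or.inr (hσ j).2.symm⟩
  · exact ⟨j, by simpa [leftEnds] using h, rfl, Or.inl rfl⟩

open Classical in
lemma IsPairing.range_qEdge (hσ : IsPairing σ) :
    Set.range (qEdge σ) = ((leftEnds σ).image (qEdge σ) : Finset (Sym2 (QVert σ))) := by
  ext e
  simp only [Set.mem_range, Finset.coe_image, Set.mem_image, Finset.mem_coe]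
  constructor
  · rintro ⟨j, rfl⟩
    obtain ⟨l, hl, h, -⟩ := hσ.exists_leftEnd j
    exact ⟨l, hl, h⟩
  · rintro ⟨l, -, rfl⟩
    exact ⟨l, rfl⟩

/-- The graph is left arbitrary because arcs of the polygon are followed both in the quotient graph
and after deleting one of its edges. -/
lemma reachable_of_steps {G : SimpleGraph (QVert σ)} {x y : Fin k} (hxy : x ≤ y)
    (h : ∀ j, x ≤ j → j < y → G.Reachable (QVert.mk σ j) (QVert.mk σ (finRotate k j))) :
    G.Reachable (QVert.mk σ x) (QVert.mk σ y) := by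
  obtain ⟨y, hy⟩ := y
  induction y with
  | zero =>
    have : x = ⟨0, hy⟩ := by ext; simpa [Fin.le_def] using hxy
    rw [this]
  | succ y ih =>
    rcases hxy.eq_or_lt with rfl | hlt
    · rfl
    · have hy' : y < k := by omega
      have hle : x ≤ ⟨y, hy'⟩ := by
        simp only [Fin.lt_def, Fin.le_def] at hlt ⊢; omega
      have hlt' : (⟨y, hy'⟩ : Fin k) < ⟨y + 1, hy⟩ := by simp [Fin.lt_def]
      refine (ih hy' hle fun j h₁ h₂ => h j h₁ (h₂.trans hlt')).trans ?_
      convert h ⟨y, hy'⟩ hle hlt' using 2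
      ext
      rw [val_finRotate]
      simp only
      rw [if_neg (by omega)]

lemma reachable_step (j : Fin k) :
    (qGraph σ).Reachable (QVert.mk σ j) (QVert.mk σ (finRotate k j)) := by
  by_cases h : QVert.mk σ j = QVert.mk σ (finRotate k j)
  · rw [← h]
  · exact SimpleGraph.Adj.reachable ((SimpleGraph.fromEdgeSet_adj _).2 ⟨⟨j, rfl⟩, h⟩)

lemma qGraph_connected (hk : 0 < k) : (qGraph σ).Connected := by
  have hz : ∀ w, (qGraph σ).Reachable (QVert.mk σ ⟨0, hk⟩) w := by
    refine QVert.ind fun j => reachable_of_steps (by simp [Fin.le_def]) fun j _ _ =>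
      reachable_step j
  exact { preconnected := fun w w' => (hz w).symm.trans (hz w')
          nonempty := ⟨QVert.mk σ ⟨0, hk⟩⟩ }

open Classical in
lemma card_edgeSet_le (hσ : IsPairing σ) : Nat.card (qGraph σ).edgeSet ≤ k / 2 := by
  have h : (qGraph σ).edgeSet ⊆ ((leftEnds σ).image (qEdge σ) : Finset (Sym2 (QVert σ))) := by
    rw [qGraph, SimpleGraph.edgeSet_fromEdgeSet, hσ.range_qEdge]
    exact Set.sdiff_subset
  have h₁ := Set.ncard_le_ncard h (Finset.finite_toSet _)
  rw [Set.ncard_coe_finset] at h₁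
  have h₂ := Finset.card_image_le (s := leftEnds σ) (f := qEdge σ)
  have := hσ.card_leftEnds
  rw [Nat.card_coe_set_eq]
  omega

theorem card_QVert_le (hk : 0 < k) (hσ : IsPairing σ) :
    Fintype.card (QVert σ) ≤ k / 2 + 1 := by
  have h := (qGraph_connected (σ := σ) hk).card_vert_le_card_edgeSet_add_one
  have := card_edgeSet_le hσ
  rw [Nat.card_eq_fintype_card] at h
  omega

open Classical in
theorem card_QVert_le_of_crossing (hk : 0 < k) (hσ : IsPairing σ) (hc : ¬ IsNonCrossing σ) :
    Fintype.card (QVert σ) ≤ k / 2 := by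
  by_contra hlt
  have hcard : Fintype.card (QVert σ) = k / 2 + 1 :=
    le_antisymm (card_QVert_le hk hσ) (by omega)
  have hconn := qGraph_connected (σ := σ) hk
  have hle := card_edgeSet_le hσ
  have hge := hconn.card_vert_le_card_edgeSet_add_one
  rw [Nat.card_eq_fintype_card, hcard] at hge
  have hE : Nat.card (qGraph σ).edgeSet = k / 2 := by omega
  -- Maximal vertex count forces a tree, and it forces the k/2 blocks to give distinct edges.
  have htree : (qGraph σ).IsTree := SimpleGraph.isTree_iff_connected_and_card.2
    ⟨hconn, by rw [Nat.card_eq_fintype_card (α := QVert σ), hcard, hE]⟩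
  have hL := hσ.card_leftEnds
  have hsub : (qGraph σ).edgeSet
      ⊆ ((leftEnds σ).image (qEdge σ) : Finset (Sym2 (QVert σ))) := by
    rw [qGraph, SimpleGraph.edgeSet_fromEdgeSet, hσ.range_qEdge]
    exact Set.sdiff_subset
  have hcle := Finset.card_image_le (s := leftEnds σ) (f := qEdge σ)
  rw [Nat.card_coe_set_eq] at hE
  have heq : (qGraph σ).edgeSet
      = ((leftEnds σ).image (qEdge σ) : Finset (Sym2 (QVert σ))) := by
    refine Set.eq_of_subset_of_ncard_le hsub ?_ (Finset.finite_toSet _)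
    rw [Set.ncard_coe_finset, hE]; omega
  have hinj : Set.InjOn (qEdge σ) (leftEnds σ) := by
    refine Finset.card_image_iff.1 ?_
    rw [heq, Set.ncard_coe_finset] at hE
    omega
  rw [IsNonCrossing, not_not] at hc
  obtain ⟨a, c, hac, hcb, hbd⟩ := hc
  have ha : a ∈ leftEnds σ := by simpa [leftEnds] using hac.trans hcb
  have hedge : ∀ j, qEdge σ j = qEdge σ a → j = a ∨ j = σ a := by
    intro j hj
    obtain ⟨l, hl, h₁, h₂⟩ := hσ.exists_leftEnd j
    have : l = a := hinj hl ha (h₁.trans hj)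
    rwa [this] at h₂
  have hmem : qEdge σ a ∈ (qGraph σ).edgeSet := by
    rw [heq]; exact Finset.mem_coe.2 (Finset.mem_image_of_mem _ ha)
  have hbr := SimpleGraph.isAcyclic_iff_forall_isBridge.1 htree.isAcyclic hmem
  rw [qEdge, SimpleGraph.isBridge_iff] at hbr
  have hstep : ∀ j, j ≠ a → j ≠ σ a → ((qGraph σ).deleteEdges {qEdge σ a}).Reachable
      (QVert.mk σ j) (QVert.mk σ (finRotate k j)) := by
    intro j h₁ h₂
    by_cases h : QVert.mk σ j = QVert.mk σ (finRotate k j)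
    · rw [← h]
    · refine SimpleGraph.Adj.reachable (SimpleGraph.deleteEdges_adj.2
        ⟨(SimpleGraph.fromEdgeSet_adj _).2 ⟨⟨j, rfl⟩, h⟩, fun h' => ?_⟩)
      rcases hedge j h' with h | h
      · exact h₁ h
      · exact h₂ h
  -- A detour from v_{a+1} to v_a avoiding both edges of the block of `a`: along the polygon to v_c,
  -- backwards over the edge at `σ c` (whose far end is glued to v_c), on to the last vertex, around
  -- to v_0 and up to v_a.
  refine hbr (SimpleGraph.Reachable.symm ?_)
  have hlast : k - 1 < k := by omega
  have hra : ((finRotate k a : Fin k) : ℕ) = a + 1 := by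
    rw [val_finRotate, if_neg]
    have := c.2
    simp only [Fin.lt_def] at hac
    omega
  have hrl : finRotate k ⟨k - 1, hlast⟩ = ⟨0, hk⟩ := by
    ext; rw [val_finRotate, if_pos]
    simp only; omega
  simp only [Fin.lt_def] at hac hcb hbd
  have s₁ := reachable_of_steps (G := (qGraph σ).deleteEdges {qEdge σ a})
    (x := finRotate k a) (y := c) (by rw [Fin.le_def, hra]; omega) fun j h₁ h₂ => by
      rw [Fin.le_def, hra] at h₁
      rw [Fin.lt_def] at h₂
      exact hstep j (fun h => by subst h; omega) (fun h => by subst h; omega)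
  have s₂ := (hstep (σ c) (fun h => by rw [h] at hbd; omega)
    (fun h => by rw [h] at hbd; omega)).symm
  rw [mk_finRotate_partner] at s₂
  have s₃ := reachable_of_steps (G := (qGraph σ).deleteEdges {qEdge σ a})
    (x := σ c) (y := ⟨k - 1, hlast⟩) (by rw [Fin.le_def]; have := (σ c).2; simp only; omega)
    fun j h₁ h₂ => by
      rw [Fin.le_def] at h₁
      exact hstep j (fun h => by subst h; omega) (fun h => by subst h; omega)
  have s₄ := hstep ⟨k - 1, hlast⟩
    (fun h => by
      have := (σ c).2
      have h' : k - 1 = (a : ℕ) := congrArg Fin.val h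
      omega)
    (fun h => by
      have := (σ c).2
      have h' : k - 1 = (σ a : ℕ) := congrArg Fin.val h
      omega)
  rw [hrl] at s₄
  have s₅ := reachable_of_steps (G := (qGraph σ).deleteEdges {qEdge σ a})
    (x := ⟨0, hk⟩) (y := a) (by simp [Fin.le_def]) fun j h₁ h₂ => by
      rw [Fin.lt_def] at h₂
      exact hstep j (fun h => by subst h; omega) (fun h => by subst h; omega)
  exact s₁.trans (s₂.trans (s₃.trans (s₄.trans s₅)))

/-- A block of a non-crossing pairing cuts the quotient graph in two parts which no other edge
joins. -/
lemma exists_cut (hσ : IsPairing σ) (hn : IsNonCrossing σ) {a : Fin k} (ha : a < σ a) :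
    ∃ χ : QVert σ → Prop, ¬ χ (QVert.mk σ a) ∧ χ (QVert.mk σ (finRotate k a)) ∧
      ∀ j, j ≠ a → j ≠ σ a → (χ (QVert.mk σ j) ↔ χ (QVert.mk σ (finRotate k j))) := by
  have hstep : ∀ j, j ≠ a → j ≠ σ a →
      ((a < j ∧ j ≤ σ a) ↔ (a < finRotate k j ∧ finRotate k j ≤ σ a)) := by
    intro j h₁ h₂
    have hv := val_finRotate j
    have h₁' : (j : ℕ) ≠ a := fun h => h₁ (Fin.ext h)
    have h₂' : (j : ℕ) ≠ σ a := fun h => h₂ (Fin.ext h)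
    have h₃ := (σ a).2
    simp only [Fin.lt_def, Fin.le_def] at ha ⊢
    split_ifs at hv <;> omega
  have hra : ((finRotate k a : Fin k) : ℕ) = a + 1 := by
    rw [val_finRotate, if_neg]
    have := (σ a).2
    simp only [Fin.lt_def] at ha
    omega
  have hin : ∀ j, a < j ∧ j < σ a → a < σ j ∧ σ j < σ a := fun j h => hσ.between hn h.1 h.2
  -- The half-open interval respects the gluing: v_{a+1} is glued to v_{σ a}, both inside, and v_{σ
  -- a + 1} to v_a, both outside.
  have hglue : ∀ j, (a < j ∧ j ≤ σ a) = (a < finRotate k (σ j) ∧ finRotate k (σ j) ≤ σ a) := by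
    intro j
    apply propext
    by_cases h₁ : j = a
    · subst h₁
      have hv := val_finRotate (σ j)
      simp only [Fin.lt_def, Fin.le_def] at ha ⊢
      split_ifs at hv <;> omega
    by_cases h₂ : j = σ a
    · subst h₂
      rw [(hσ a).2]
      simp only [Fin.lt_def, Fin.le_def, hra] at ha ⊢
      omega
    · have h₃ : σ j ≠ a := fun h => h₂ (by rw [← h, (hσ j).2])
      have h₄ : σ j ≠ σ a := fun h => h₁ (hσ.injective h)
      rw [← hstep (σ j) h₃ h₄]
      constructor
      · intro h
        have := hin j ⟨h.1, lt_of_le_of_ne h.2 h₂⟩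
        exact ⟨this.1, this.2.le⟩
      · intro h
        have := hin (σ j) ⟨h.1, lt_of_le_of_ne h.2 h₄⟩
        rw [(hσ j).2] at this
        exact ⟨this.1, this.2.le⟩
  refine ⟨QVert.lift (fun j => a < j ∧ j ≤ σ a) hglue, by simp, ?_, fun j h₁ h₂ => ?_⟩
  · simp only [QVert.lift_mk, Fin.lt_def, Fin.le_def, hra] at ha ⊢
    omega
  · simpa using hstep j h₁ h₂

open Classical in
-- By `exists_cut`, no edge is a loop, no two blocks give the same edge, and every edge is a bridge.
-- So the graph is a tree with one edge per block.
theorem card_QVert_of_nonCrossing (hk : 0 < k) (hσ : IsPairing σ) (hn : IsNonCrossing σ) :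
    Fintype.card (QVert σ) = k / 2 + 1 := by
  have hconn := qGraph_connected (σ := σ) hk
  have hne : ∀ a ∈ leftEnds σ, QVert.mk σ a ≠ QVert.mk σ (finRotate k a) := by
    intro a ha h
    obtain ⟨χ, h₁, h₂, -⟩ := exists_cut hσ hn (by simpa [leftEnds] using ha)
    rw [← h] at h₂
    exact h₁ h₂
  have hedge : ∀ a ∈ leftEnds σ, ∀ j, qEdge σ j = qEdge σ a → j = a ∨ j = σ a := by
    intro a ha j hj
    obtain ⟨χ, h₁, h₂, h₃⟩ := exists_cut hσ hn (by simpa [leftEnds] using ha)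
    by_contra! hcon
    have h₄ := h₃ j hcon.1 hcon.2
    rcases Sym2.eq_iff.1 hj with ⟨h, h'⟩ | ⟨h, h'⟩ <;> rw [h, h'] at h₄ <;> tauto
  have hinj : Set.InjOn (qEdge σ) (leftEnds σ) := by
    intro j hj a ha h
    rcases hedge a ha j h with h' | h'
    · exact h'
    · have h₁ : j < σ j := by simpa [leftEnds] using hj
      have h₂ : a < σ a := by simpa [leftEnds] using ha
      rw [h', (hσ a).2] at h₁
      exact absurd h₁ h₂.not_gt
  have heq : (qGraph σ).edgeSet
      = ((leftEnds σ).image (qEdge σ) : Finset (Sym2 (QVert σ))) := by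
    rw [qGraph, SimpleGraph.edgeSet_fromEdgeSet, hσ.range_qEdge]
    refine sdiff_eq_left.2 (Set.disjoint_left.2 ?_)
    intro e he
    obtain ⟨a, ha, rfl⟩ := Finset.mem_image.1 (Finset.mem_coe.1 he)
    exact fun h => hne a ha h
  have hac : (qGraph σ).IsAcyclic := by
    rw [SimpleGraph.isAcyclic_iff_forall_isBridge]
    intro e he
    rw [heq] at he
    obtain ⟨a, ha, rfl⟩ := Finset.mem_image.1 (Finset.mem_coe.1 he)
    rw [qEdge, SimpleGraph.isBridge_iff]
    obtain ⟨χ, h₁, h₂, h₃⟩ := exists_cut hσ hn (by simpa [leftEnds] using ha)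
    rintro ⟨p⟩
    have hwalk : ∀ w w', ((qGraph σ).deleteEdges
        {s(QVert.mk σ a, QVert.mk σ (finRotate k a))}).Walk w w' → (χ w ↔ χ w') := by
      intro w w' p
      induction p with
      | nil => rfl
      | cons h _ ih =>
        refine Iff.trans ?_ ih
        obtain ⟨h, h'⟩ := SimpleGraph.deleteEdges_adj.1 h
        obtain ⟨⟨j, hj⟩, -⟩ := (SimpleGraph.fromEdgeSet_adj _).1 h
        rw [← hj] at h'
        have h₄ := h₃ j (fun h => h' (by rw [h]; rfl))
          (fun h => h' (by rw [h, qEdge_partner hσ]; rfl))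
        rcases Sym2.eq_iff.1 hj with ⟨h, h'⟩ | ⟨h, h'⟩ <;> rw [h, h'] at h₄
        · exact h₄
        · exact h₄.symm
    exact h₁ ((hwalk _ _ p).2 h₂)
  have htree : (qGraph σ).IsTree := ⟨hconn, hac⟩
  have hc := (SimpleGraph.isTree_iff_connected_and_card.1 htree).2
  rw [Nat.card_coe_set_eq, heq, Set.ncard_coe_finset, Finset.card_image_iff.2 hinj,
    Nat.card_eq_fintype_card] at hc
  have := hσ.card_leftEnds
  omega

end Pairing

/-! ### Counting labelings of a finite set -/

section Labelings

variable {V : Type*} [Fintype V]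

open Classical in
lemma exists_equiv_fin_of_strictTotalOrder (r : V → V → Prop) [IsStrictTotalOrder V r] :
    ∃ e : Fin (Fintype.card V) ≃ V, ∀ i j, r (e i) (e j) ↔ i < j := by
  let _ : LinearOrder V := linearOrderOfSTO r
  let e := Fintype.orderIsoFinOfCardEq V rfl
  exact ⟨e.toEquiv, fun i j => e.lt_iff_lt⟩

lemma card_orderEmbedding_fin (d n : ℕ) : Nat.card (Fin d ↪o Fin n) = n.choose d := by
  rw [Nat.card_congr Set.powersetCard.ofFinEmbEquiv]
  rw [Set.powersetCard.card, Nat.card_eq_fintype_card, Fintype.card_fin]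

/-- Listing `V` in the order `r` turns these labelings into order embeddings of `Fin d` in `Fin n`,
that is, d-element subsets. -/
lemma card_labelings_of_order (r : V → V → Prop) (hr : IsStrictTotalOrder V r) (n : ℕ) :
    Nat.card {f : V → Fin n // ∀ w w', r w w' ↔ f w < f w'} = n.choose (Fintype.card V) := by
  obtain ⟨e, he⟩ := exists_equiv_fin_of_strictTotalOrder r
  rw [← card_orderEmbedding_fin]
  refine Nat.card_congr
    { toFun := fun f => OrderEmbedding.ofStrictMono (fun i => f.1 (e i))
        fun i j h => (f.2 _ _).1 ((he i j).2 h)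
      invFun := fun g => ⟨fun w => g (e.symm w), fun w w' => by
        rw [OrderEmbedding.lt_iff_lt, ← he]; simp⟩
      left_inv := fun f =>
        Subtype.ext (funext fun w => congrArg f.1 (e.apply_symm_apply w))
      right_inv := fun g => by ext; simp }

open Classical in
/-- The number of injective labelings in `Fin n` that increase along the relation `A`. -/
lemma card_injective_labelings (A : V → V → Prop) (n : ℕ) :
    Nat.card {f : V → Fin n // Function.Injective f ∧ ∀ w w', A w w' → f w < f w'}
      = Nat.card {r : V → V → Prop // IsStrictTotalOrder V r ∧ ∀ w w', A w w' → r w w'}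
        * n.choose (Fintype.card V) := by
  let R := {r : V → V → Prop // IsStrictTotalOrder V r ∧ ∀ w w', A w w' → r w w'}
  -- An injective labeling pulls back exactly one strict total order from `Fin n`; the labelings are
  -- sorted by that order.
  let F : (Σ r : R, {f : V → Fin n // ∀ w w', r.1 w w' ↔ f w < f w'}) →
      {f : V → Fin n // Function.Injective f ∧ ∀ w w', A w w' → f w < f w'} := fun p =>
    ⟨p.2.1, by
      intro w w' h
      have := p.1.2.1
      by_contra hne
      rcases trichotomous_of p.1.1 w w' with h' | h' | h'
      · exact ((p.2.2 _ _).1 h').ne h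
      · exact hne h'
      · exact ((p.2.2 _ _).1 h').ne h.symm, fun w w' h => (p.2.2 _ _).1 (p.1.2.2 _ _ h)⟩
  have hF : Function.Bijective F := by
    constructor
    · rintro ⟨⟨r, hr⟩, f, hf⟩ ⟨⟨r', hr'⟩, f', hf'⟩ h
      obtain rfl : f = f' := congrArg Subtype.val h
      obtain rfl : r = r' := by
        ext w w'; exact (hf w w').trans (hf' w w').symm
      rfl
    · rintro ⟨f, hf, hA⟩
      refine ⟨⟨⟨fun w w' => f w < f w', ?_, hA⟩, f, fun _ _ => Iff.rfl⟩, rfl⟩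
      exact { irrefl := fun w => lt_irrefl _
              trans := fun _ _ _ => lt_trans
              trichotomous := fun w w' h h' => hf (le_antisymm (not_lt.1 h') (not_lt.1 h)) }
  rw [← Nat.card_congr (Equiv.ofBijective F hF), Nat.card_sigma,
    Finset.sum_congr rfl fun r _ => card_labelings_of_order r.1 r.2.1 n, Finset.sum_const,
    Finset.card_univ, smul_eq_mul, Nat.card_eq_fintype_card]

lemma tendsto_descFactorial_div (d : ℕ) :
    Tendsto (fun n : ℕ => (n.descFactorial d : ℝ) / (n : ℝ) ^ d) atTop (𝓝 1) := by
  refine (Asymptotics.isEquivalent_iff_tendsto_one ?_).1 (isEquivalent_descFactorial d)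
  filter_upwards [eventually_gt_atTop 0] with n hn
  positivity

open Classical in
/-- The asymptotics of a sum over the labelings that increase along `A`, of a bounded function
which is constant on injective labelings. -/
lemma tendsto_sum_labelings (A : V → V → Prop) (M : (n : ℕ) → (V → Fin n) → ℂ) (C : ℝ) (c : ℂ)
    (hM : ∀ n f, ‖M n f‖ ≤ C) (hc : ∀ n f, Function.Injective f → M n f = c) :
    Tendsto (fun n : ℕ => ((n : ℂ) ^ Fintype.card V)⁻¹ *
      ∑ f : V → Fin n with ∀ w w', A w w' → f w < f w', M n f) atTop
      (𝓝 (c * Nat.card {r : V → V → Prop //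
        IsStrictTotalOrder V r ∧ ∀ w w', A w w' → r w w'} / (Fintype.card V).factorial)) := by
  set d := Fintype.card V
  set N := Nat.card {r : V → V → Prop // IsStrictTotalOrder V r ∧ ∀ w w', A w w' → r w w'}
  have hdesc := tendsto_descFactorial_div d
  have h₁ : Tendsto (fun n : ℕ => ((n : ℂ) ^ d)⁻¹ * (c * N * (n.choose d : ℂ))) atTop
      (𝓝 (c * N / d.factorial)) := by
    have h := ((Complex.continuous_ofReal.tendsto 1).comp hdesc).const_mul (c * N / d.factorial)
    simp only [Complex.ofReal_one, mul_one] at h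
    refine h.congr fun n => ?_
    have : (d.factorial : ℂ) ≠ 0 := by exact_mod_cast d.factorial_ne_zero
    simp only [Function.comp_apply, Nat.descFactorial_eq_factorial_mul_choose]
    push_cast
    field_simp
  -- Non-injective labelings number `n ^ d - n.descFactorial d`, a vanishing fraction, so the bound
  -- on `M` disposes of them.
  have h₂ : Tendsto (fun n : ℕ => ((n : ℂ) ^ d)⁻¹ *
      ∑ f : V → Fin n with (∀ w w', A w w' → f w < f w') ∧ ¬ Function.Injective f, M n f) atTop
      (𝓝 0) := by
    have hb : Tendsto (fun n : ℕ => C * (1 - (n.descFactorial d : ℝ) / (n : ℝ) ^ d)) atTop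
        (𝓝 0) := by
      simpa using (hdesc.const_sub 1).const_mul C
    refine squeeze_zero_norm' ?_ hb
    filter_upwards [eventually_gt_atTop 0] with n hn
    have hpos : (0 : ℝ) < (n : ℝ) ^ d := by positivity
    have hC : 0 ≤ C := (norm_nonneg _).trans (hM n fun _ => ⟨0, hn⟩)
    have hcount : (Finset.univ.filter fun f : V → Fin n => ¬ Function.Injective f).card
        + n.descFactorial d = n ^ d := by
      have h := Finset.card_filter_add_card_filter_not (s := (Finset.univ : Finset (V → Fin n)))
        (fun f => Function.Injective f)
      have h' : (Finset.univ.filter fun f : V → Fin n => Function.Injective f).card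
          = n.descFactorial d := by
        rw [← Fintype.card_subtype, Fintype.card_congr (Equiv.subtypeInjectiveEquivEmbedding V _),
          Fintype.card_embedding_eq, Fintype.card_fin]
      rw [h', Finset.card_univ, Fintype.card_fun, Fintype.card_fin] at h
      change _ = n ^ d at h
      omega
    have hsum : ‖∑ f : V → Fin n with (∀ w w', A w w' → f w < f w') ∧ ¬ Function.Injective f,
        M n f‖ ≤ C * ((n : ℝ) ^ d - n.descFactorial d) := by
      refine (norm_sum_le_of_le _ fun f _ => hM n f).trans ?_
      rw [Finset.sum_const, nsmul_eq_mul, mul_comm]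
      refine mul_le_mul_of_nonneg_left ?_ hC
      rw [le_sub_iff_add_le]
      have : (Finset.univ.filter fun f : V → Fin n =>
          (∀ w w', A w w' → f w < f w') ∧ ¬ Function.Injective f).card
          ≤ (Finset.univ.filter fun f : V → Fin n => ¬ Function.Injective f).card :=
        Finset.card_le_card fun f => by simp +contextual
      have h := (Nat.add_le_add_right this (n.descFactorial d)).trans_eq hcount
      exact_mod_cast h
    rw [norm_mul, norm_inv, norm_pow, Complex.norm_natCast]
    calc ((n : ℝ) ^ d)⁻¹ * _ ≤ ((n : ℝ) ^ d)⁻¹ * (C * ((n : ℝ) ^ d - n.descFactorial d)) :=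
          mul_le_mul_of_nonneg_left hsum (by positivity)
      _ = C * (1 - (n.descFactorial d : ℝ) / (n : ℝ) ^ d) := by field_simp
  have h := h₁.add h₂
  rw [add_zero] at h
  refine h.congr fun n => ?_
  rw [← mul_add]
  congr 1
  rw [← Finset.sum_filter_add_sum_filter_not
    (Finset.univ.filter fun f : V → Fin n => ∀ w w', A w w' → f w < f w')
    (fun f => Function.Injective f), Finset.filter_filter, Finset.filter_filter]
  congr 1
  rw [Finset.sum_congr rfl fun f hf => hc n f (Finset.mem_filter.1 hf).2.2, Finset.sum_const,
    ← Fintype.card_subtype, ← Nat.card_eq_fintype_card, nsmul_eq_mul]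
  have := card_injective_labelings A n
  simp only [and_comm] at this ⊢
  rw [this]
  push_cast
  ring

open Classical in
-- There are at most n^|V| labelings, which leaves at least one factor 1/n.
lemma tendsto_sum_labelings_of_card_lt (A : V → V → Prop) (M : (n : ℕ) → (V → Fin n) → ℂ) (C : ℝ)
    (hM : ∀ n f, ‖M n f‖ ≤ C) {m : ℕ} (hm : Fintype.card V < m) :
    Tendsto (fun n : ℕ => ((n : ℂ) ^ m)⁻¹ *
      ∑ f : V → Fin n with ∀ w w', A w w' → f w < f w', M n f) atTop (𝓝 0) := by
  have hb : Tendsto (fun n : ℕ => C * ((n : ℝ))⁻¹) atTop (𝓝 0) := by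
    simpa using (tendsto_inv_atTop_nhds_zero_nat (𝕜 := ℝ)).const_mul C
  refine squeeze_zero_norm' ?_ hb
  filter_upwards [eventually_gt_atTop 0] with n hn
  have hC : 0 ≤ C := (norm_nonneg _).trans (hM n fun _ => ⟨0, hn⟩)
  have hn1 : (1 : ℝ) ≤ n := by exact_mod_cast hn
  have hsum : ‖∑ f : V → Fin n with ∀ w w', A w w' → f w < f w', M n f‖
      ≤ C * (n : ℝ) ^ Fintype.card V := by
    refine (norm_sum_le_of_le _ fun f _ => hM n f).trans ?_
    rw [Finset.sum_const, nsmul_eq_mul, mul_comm]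
    refine mul_le_mul_of_nonneg_left ?_ hC
    have := Finset.card_filter_le (Finset.univ : Finset (V → Fin n))
      (fun f => ∀ w w', A w w' → f w < f w')
    rw [Finset.card_univ, Fintype.card_fun, Fintype.card_fin] at this
    exact_mod_cast this
  rw [norm_mul, norm_inv, norm_pow, Complex.norm_natCast]
  obtain ⟨l, rfl⟩ : ∃ l, m = Fintype.card V + l + 1 := ⟨m - Fintype.card V - 1, by omega⟩
  calc ((n : ℝ) ^ (Fintype.card V + l + 1))⁻¹ * _
      ≤ ((n : ℝ) ^ (Fintype.card V + l + 1))⁻¹ * (C * (n : ℝ) ^ Fintype.card V) :=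
        mul_le_mul_of_nonneg_left hsum (by positivity)
    _ = ((n : ℝ) ^ l)⁻¹ * (C * (n : ℝ)⁻¹) := by field_simp; ring
    _ ≤ 1 * (C * (n : ℝ)⁻¹) := mul_le_mul_of_nonneg_right
        (inv_le_one_of_one_le₀ (one_le_pow₀ hn1)) (by positivity)
    _ = C * (n : ℝ)⁻¹ := one_mul _

end Labelings

/-! ### Moments of complex Gaussian variables -/

section Gaussian

/-- Rotation by π/(m - m') preserves Lebesgue measure and multiplies the integrand by -1, so the
integral equals its negative. No integrability is needed. -/
lemma integral_rotation_eq_zero {m m' : ℕ} (h : m ≠ m') (g : ℝ → ℝ) :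
    ∫ z : ℂ, (g ‖z‖ : ℂ) * (z ^ m * conj z ^ m') = 0 := by
  set t : ℝ := Real.pi / ((m : ℝ) - m')
  have hne : (m : ℝ) - m' ≠ 0 := sub_ne_zero.2 (by exact_mod_cast h)
  have hc : Complex.exp (t * Complex.I) ^ m * conj (Complex.exp (t * Complex.I)) ^ m' = -1 := by
    rw [← Complex.exp_conj, ← Complex.exp_nat_mul, ← Complex.exp_nat_mul, ← Complex.exp_add,
      ← Complex.exp_pi_mul_I]
    congr 1
    have : (t : ℂ) * (m - m') = Real.pi := by
      have : t * ((m : ℝ) - m') = Real.pi := div_mul_cancel₀ _ hne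
      exact_mod_cast this
    simp only [map_mul, Complex.conj_ofReal, Complex.conj_I]
    linear_combination Complex.I * this
  have key := ((rotation (Circle.exp t)).measurePreserving).integral_comp
    (rotation (Circle.exp t)).toHomeomorph.measurableEmbedding
    (fun z : ℂ => (g ‖z‖ : ℂ) * (z ^ m * conj z ^ m'))
  have hfun : (fun z : ℂ => (g ‖rotation (Circle.exp t) z‖ : ℂ) *
      ((rotation (Circle.exp t) z) ^ m * conj (rotation (Circle.exp t) z) ^ m'))
      = fun z => -((g ‖z‖ : ℂ) * (z ^ m * conj z ^ m')) := by
    funext z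
    rw [LinearIsometryEquiv.norm_map, rotation_apply, Circle.coe_exp, map_mul, mul_pow, mul_pow]
    linear_combination ((g ‖z‖ : ℂ) * (z ^ m * conj z ^ m')) * hc
  rw [hfun, integral_neg] at key
  linear_combination (-1 / 2 : ℂ) * key

/-- For m = m' the integrand is radial and gives Γ(m + 1); otherwise rotation invariance applies. -/
lemma integral_complexGaussian_weight {v : ℝ} (hv : 0 < v) (m m' : ℕ) :
    ∫ z : ℂ, (((Real.pi * v)⁻¹ * Real.exp (-‖z‖ ^ 2 / v) : ℝ) : ℂ) * (z ^ m * conj z ^ m')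
      = if m = m' then (m.factorial : ℂ) * (v : ℂ) ^ m else 0 := by
  split_ifs with h
  · subst h
    have hfun : (fun z : ℂ => (((Real.pi * v)⁻¹ * Real.exp (-‖z‖ ^ 2 / v) : ℝ) : ℂ) *
        (z ^ m * conj z ^ m)) = fun z => (((Real.pi * v)⁻¹ *
          (‖z‖ ^ (2 * m : ℝ) * Real.exp (-v⁻¹ * ‖z‖ ^ (2 : ℝ))) : ℝ) : ℂ) := by
      funext z
      have h₁ : z ^ m * conj z ^ m = ((‖z‖ ^ (2 * m : ℝ) : ℝ) : ℂ) := by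
        rw [← mul_pow, Complex.mul_conj', Real.rpow_mul (norm_nonneg z), Real.rpow_natCast,
          Real.rpow_two]
        push_cast; ring
      have h₂ : -‖z‖ ^ 2 / v = -v⁻¹ * ‖z‖ ^ (2 : ℝ) := by rw [Real.rpow_two]; field_simp
      rw [h₁, h₂]
      push_cast; ring
    rw [hfun, integral_complex_ofReal, integral_const_mul,
      Complex.integral_rpow_mul_exp_neg_mul_rpow (by norm_num)
        (by linarith [m.cast_nonneg (α := ℝ)]) (inv_pos.2 hv)]
    have h₃ : ((2 : ℝ) * m + 2) / 2 = m + 1 := by ring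
    have h₄ : -((2 : ℝ) * m + 2) / 2 = -((m + 1 : ℕ) : ℝ) := by push_cast; ring
    rw [h₃, h₄, Real.Gamma_nat_eq_factorial, Real.rpow_neg (inv_pos.2 hv).le, Real.rpow_natCast,
      inv_pow, inv_inv, pow_succ]
    have hpi := Real.pi_pos
    have : (Real.pi * v)⁻¹ * (2 * Real.pi / 2 * (v ^ m * v) * (m.factorial : ℝ))
        = m.factorial * v ^ m := by
      field_simp
    rw [this]
    push_cast; ring
  · exact integral_rotation_eq_zero h fun r => (Real.pi * v)⁻¹ * Real.exp (-r ^ 2 / v)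

variable {Ω : Type*} [MeasurableSpace Ω] {P : Measure Ω}

lemma IsComplexGaussian.aemeasurable {a : Ω → ℂ} {v : ℝ≥0} (h : IsComplexGaussian P a v) :
    AEMeasurable a P := by
  have h₁ : AEMeasurable (fun ω => ((a ω).re : ℂ) + ((a ω).im : ℂ) * Complex.I) P :=
    ((Complex.measurable_ofReal.comp_aemeasurable h.1.aemeasurable)).add
      ((Complex.measurable_ofReal.comp_aemeasurable h.2.1.aemeasurable).mul_const _)
  simpa only [Complex.re_add_im] using h₁

/-- Two independent Gaussian densities of variance v/2 multiply to a radial density on the plane. A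
degenerate Gaussian has no density, hence `v ≠ 0`. -/
lemma IsComplexGaussian.integral_comp [IsProbabilityMeasure P] {a : Ω → ℂ} {v : ℝ≥0} (hv : v ≠ 0)
    (h : IsComplexGaussian P a v) {F : ℂ → ℂ} (hF : Measurable F) :
    ∫ ω, F (a ω) ∂P
      = ∫ z : ℂ, (((Real.pi * v)⁻¹ * Real.exp (-‖z‖ ^ 2 / v) : ℝ) : ℂ) * F z := by
  have hv2 : v / 2 ≠ 0 := by positivity
  have hmap : P.map (fun ω => ((a ω).re, (a ω).im))
      = (gaussianReal 0 (v / 2)).prod (gaussianReal 0 (v / 2)) := by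
    rw [(indepFun_iff_map_prod_eq_prod_map_map h.1.aemeasurable h.2.1.aemeasurable).1 h.2.2,
      h.1.map_eq, h.2.1.map_eq]
  have hG : Measurable fun p : ℝ × ℝ => F (Complex.measurableEquivRealProd.symm p) :=
    hF.comp Complex.measurableEquivRealProd.symm.measurable
  have h₁ : ∫ ω, F (a ω) ∂P = ∫ p, F (Complex.measurableEquivRealProd.symm p)
      ∂((gaussianReal 0 (v / 2)).prod (gaussianReal 0 (v / 2))) := by
    rw [← hmap, integral_map (h.1.aemeasurable.prodMk h.2.1.aemeasurable)
      hG.aestronglyMeasurable]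
    rfl
  rw [h₁, gaussianReal_of_var_ne_zero 0 hv2, prod_withDensity (measurable_gaussianPDF _ _)
    (measurable_gaussianPDF _ _), integral_withDensity_eq_integral_toReal_smul (by fun_prop)
      (Eventually.of_forall fun p => ENNReal.mul_lt_top gaussianPDF_lt_top gaussianPDF_lt_top),
    ← (Complex.volume_preserving_equiv_real_prod.symm).integral_comp
      Complex.measurableEquivRealProd.symm.measurableEmbedding]
  refine integral_congr_ae (Eventually.of_forall fun p => ?_)
  have hv0 : (0 : ℝ) < v := by exact_mod_cast pos_iff_ne_zero.2 hv
  have hn : ‖Complex.measurableEquivRealProd.symm p‖ ^ 2 = p.1 ^ 2 + p.2 ^ 2 := by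
    rw [Complex.sq_norm, Complex.normSq_apply]
    simp [Complex.measurableEquivRealProd_symm_apply]
    ring
  have hs : (√(2 * Real.pi * ((v / 2 : ℝ≥0) : ℝ)))⁻¹ * (√(2 * Real.pi * ((v / 2 : ℝ≥0) : ℝ)))⁻¹
      = (Real.pi * v)⁻¹ := by
    rw [← mul_inv, Real.mul_self_sqrt (by positivity)]
    push_cast
    congr 1; ring
  have hpdf : (gaussianPDF 0 (v / 2) p.1 * gaussianPDF 0 (v / 2) p.2).toReal
      = (Real.pi * v)⁻¹ * Real.exp (-(p.1 ^ 2 + p.2 ^ 2) / v) := by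
    rw [ENNReal.toReal_mul, toReal_gaussianPDF, toReal_gaussianPDF, gaussianPDFReal_def, ← hs]
    simp only [sub_zero]
    rw [mul_mul_mul_comm, ← Real.exp_add]
    congr 2
    push_cast
    field_simp
    ring
  simp only [hpdf, hn, Complex.real_smul]

/-- The `*`-moments of a complex Gaussian random variable. -/
theorem IsComplexGaussian.moment [IsProbabilityMeasure P] {a : Ω → ℂ} {v : ℝ≥0} (hv : v ≠ 0)
    (h : IsComplexGaussian P a v) (m m' : ℕ) :
    ∫ ω, a ω ^ m * conj (a ω) ^ m' ∂P
      = if m = m' then (m.factorial : ℂ) * (v : ℂ) ^ m else 0 := by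
  have hv0 : (0 : ℝ) < v := by exact_mod_cast pos_iff_ne_zero.2 hv
  rw [h.integral_comp hv (F := fun z => z ^ m * conj z ^ m')
    (by exact (by fun_prop : Continuous fun z : ℂ => z ^ m * conj z ^ m').measurable)]
  exact integral_complexGaussian_weight hv0 m m'

end Gaussian

/-! ### Wick's formula -/

section Wick

variable {k : ℕ} {ι : Type*}

lemma Expo.ne_one_iff {e : Expo} : e ≠ Expo.one ↔ e = Expo.star := by
  cases e <;> simp

open Classical in
/-- Compatible pairings within the fibers of `e` are the same as bijections over `e` between the
positions of the two exponents. -/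
noncomputable def pairingEquiv (ε : Fin k → Expo) (e : Fin k → ι) :
    {σ : Fin k → Fin k // IsPairing σ ∧ IsCompatible ε σ ∧ ∀ j, e (σ j) = e j} ≃
    {φ : {j // ε j = Expo.one} ≃ {j // ε j ≠ Expo.one} // ∀ a, e (φ a).1 = e a.1} where
  toFun σ := ⟨
    { toFun := fun a => ⟨σ.1 a.1, fun h => σ.2.2.1 a.1 (a.2.trans h.symm)⟩
      invFun := fun b => ⟨σ.1 b.1, by
        by_contra h
        exact σ.2.2.1 b.1 ((Expo.ne_one_iff.1 b.2).trans (Expo.ne_one_iff.1 h).symm)⟩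
      left_inv := fun a => Subtype.ext (σ.2.1 a.1).2
      right_inv := fun b => Subtype.ext (σ.2.1 b.1).2 }, fun a => σ.2.2.2 a.1⟩
  invFun φ := ⟨fun j => if h : ε j = Expo.one then (φ.1 ⟨j, h⟩).1 else (φ.1.symm ⟨j, h⟩).1, by
    refine ⟨fun j => ?_, fun j => ?_, fun j => ?_⟩
    · by_cases h : ε j = Expo.one
      · have h' := (φ.1 ⟨j, h⟩).2
        simp only [h, dite_true]
        exact ⟨fun h₁ => h' (by rw [h₁, h]), by simp [h']⟩
      · have h' := (φ.1.symm ⟨j, h⟩).2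
        simp only [h, dite_false]
        exact ⟨fun h₁ => h (by rw [← h₁, h']), by simp [h']⟩
    · by_cases h : ε j = Expo.one
      · simp only [h, dite_true]
        exact (φ.1 ⟨j, h⟩).2.symm
      · simp only [h, dite_false]
        rw [(φ.1.symm ⟨j, h⟩).2]; exact h
    · by_cases h : ε j = Expo.one
      · simp only [h, dite_true]; exact φ.2 ⟨j, h⟩
      · simp only [h, dite_false]
        have := φ.2 (φ.1.symm ⟨j, h⟩)
        rw [Equiv.apply_symm_apply] at this
        exact this.symm⟩
  left_inv σ := by
    ext j
    by_cases h : ε j = Expo.one <;> simp [h]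
  right_inv φ := by
    ext a
    simp [a.2]

/-- Composing with one fixed such bijection turns the others into permutations of `A` preserving
`f`, whose number is the product of the factorials of the fiber sizes. If some fiber sizes differ
there is no such bijection. -/
lemma card_equiv_over {A B : Type*} [Fintype A] [Fintype B] [Fintype ι] [DecidableEq A]
    [DecidableEq ι] (f : A → ι) (g : B → ι) :
    Nat.card {φ : A ≃ B // ∀ a, g (φ a) = f a}
      = ∏ x, if Fintype.card {a // f a = x} = Fintype.card {b // g b = x}
          then (Fintype.card {a // f a = x}).factorial else 0 := by
  by_cases h : ∀ x, Fintype.card {a // f a = x} = Fintype.card {b // g b = x}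
  · simp only [h, if_true]
    let φ₀ : A ≃ B := Equiv.ofFiberEquiv fun x => Fintype.equivOfCardEq (h x)
    have hφ₀ : ∀ a, g (φ₀ a) = f a := Equiv.ofFiberEquiv_map _
    have hφ₀' : ∀ b, f (φ₀.symm b) = g b := fun b => by
      rw [← hφ₀, Equiv.apply_symm_apply]
    simp only [← h]
    rw [← DomMulAct.stabilizer_card f, ← Nat.card_eq_fintype_card]
    exact Nat.card_congr
      { toFun := fun φ => ⟨φ.1.trans φ₀.symm, by ext a; simp [hφ₀', φ.2]⟩
        invFun := fun s => ⟨s.1.trans φ₀, fun a => by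
          simpa [hφ₀] using congrFun s.2 a⟩
        left_inv := fun φ => by ext; simp
        right_inv := fun s => by ext; simp }
  · push Not at h
    obtain ⟨x, hx⟩ := h
    rw [Finset.prod_eq_zero (Finset.mem_univ x) (if_neg hx)]
    have : IsEmpty {φ : A ≃ B // ∀ a, g (φ a) = f a} := by
      refine ⟨fun φ => hx (Fintype.card_congr ?_)⟩
      exact φ.1.subtypeEquiv fun a => by rw [φ.2]
    exact Nat.card_of_isEmpty

variable {Ω : Type*} [MeasurableSpace Ω] {P : Measure Ω}

/-- Wick's formula for words in independent complex Gaussian variables and their conjugates. -/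
theorem wick_formula [IsProbabilityMeasure P] [Fintype ι] {t : ι → Ω → ℂ} {v : ℝ≥0} (hv : v ≠ 0)
    (ht : ∀ x, IsComplexGaussian P (t x) v) (hi : iIndepFun t P) (ε : Fin k → Expo)
    (e : Fin k → ι) :
    ∫ ω, ∏ j, (ε j).app (t (e j) ω) ∂P = (v : ℂ) ^ (k / 2) *
      Nat.card {σ : Fin k → Fin k // IsPairing σ ∧ IsCompatible ε σ ∧ ∀ j, e (σ j) = e j} := by
  classical
  -- `m x` and `m' x` count the occurrences of `t x` and of its conjugate. The factorial in the
  -- Gaussian moment is the number of bijections between the two sets of positions.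
  set m : ι → ℕ := fun x => Fintype.card {a : {j // ε j = Expo.one} // e a.1 = x}
  set m' : ι → ℕ := fun x => Fintype.card {a : {j // ε j ≠ Expo.one} // e a.1 = x}
  have hm : ∀ x, m x = ((Finset.univ.filter fun j => e j = x).filter
      fun j => ε j = Expo.one).card := fun x => by
    rw [Finset.filter_filter, ← Fintype.card_subtype]
    refine Fintype.card_congr ((Equiv.subtypeSubtypeEquivSubtypeInter (fun j => ε j = Expo.one)
      (fun j => e j = x)).trans (Equiv.subtypeEquivRight fun j => and_comm))
  have hm' : ∀ x, m' x = ((Finset.univ.filter fun j => e j = x).filter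
      fun j => ¬ ε j = Expo.one).card := fun x => by
    rw [Finset.filter_filter, ← Fintype.card_subtype]
    refine Fintype.card_congr ((Equiv.subtypeSubtypeEquivSubtypeInter (fun j => ε j ≠ Expo.one)
      (fun j => e j = x)).trans (Equiv.subtypeEquivRight fun j => and_comm))
  have hprod : ∀ ω, ∏ j, (ε j).app (t (e j) ω)
      = ∏ x, (t x ω) ^ m x * conj (t x ω) ^ m' x := by
    intro ω
    rw [← Finset.prod_fiberwise Finset.univ e]
    refine Finset.prod_congr rfl fun x _ => ?_
    rw [← Finset.prod_filter_mul_prod_filter_not _ (fun j => ε j = Expo.one), hm, hm']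
    congr 1
    · refine Finset.prod_eq_pow_card fun j hj => ?_
      simp only [Finset.mem_filter, Finset.mem_univ, true_and] at hj
      rw [hj.2, hj.1]; rfl
    · refine Finset.prod_eq_pow_card fun j hj => ?_
      simp only [Finset.mem_filter, Finset.mem_univ, true_and] at hj
      rw [Expo.ne_one_iff.1 hj.2, hj.1]; rfl
  simp_rw [hprod]
  rw [hi.integral_fun_prod_comp (f := fun x z => z ^ m x * conj z ^ m' x)
    (fun x => (ht x).aemeasurable) fun x =>
      (by fun_prop : Continuous fun z : ℂ => z ^ m x * conj z ^ m' x).aestronglyMeasurable]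
  simp_rw [fun x => (ht x).moment hv (m x) (m' x)]
  rw [Nat.card_congr (pairingEquiv ε e), card_equiv_over
    (fun a : {j // ε j = Expo.one} => e a.1) (fun b : {j // ε j ≠ Expo.one} => e b.1)]
  change _ = _ * ((∏ x, if m x = m' x then (m x).factorial else 0 : ℕ) : ℂ)
  by_cases h : ∀ x, m x = m' x
  · have hsum : ∑ x, m x = k / 2 := by
      have h₁ : ∑ x, m x = (Finset.univ.filter fun j => ε j = Expo.one).card := by
        simp_rw [hm, Finset.filter_filter, and_comm (a := e _ = _), ← Finset.filter_filter]
        exact (Finset.card_eq_sum_card_fiberwise fun _ _ => Finset.mem_univ _).symm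
      have h₂ : ∑ x, m x = (Finset.univ.filter fun j => ¬ ε j = Expo.one).card := by
        simp_rw [h, hm', Finset.filter_filter, and_comm (a := e _ = _), ← Finset.filter_filter]
        exact (Finset.card_eq_sum_card_fiberwise fun _ _ => Finset.mem_univ _).symm
      have h₃ := Finset.card_filter_add_card_filter_not (s := (Finset.univ : Finset (Fin k)))
        (fun j => ε j = Expo.one)
      rw [Finset.card_univ, Fintype.card_fin] at h₃
      omega
    simp only [h, if_true]
    simp only [← h]
    rw [Finset.prod_mul_distrib, Finset.prod_pow_eq_pow_sum, hsum]
    push_cast; ring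
  · push Not at h
    obtain ⟨x, hx⟩ := h
    rw [Finset.prod_eq_zero (Finset.mem_univ x) (if_neg hx),
      Finset.prod_eq_zero (Finset.mem_univ x) (if_neg hx)]
    simp

end Wick

/-! ### Words and traces -/

section Words

lemma prod_ofFn_apply {n : ℕ} : ∀ {k : ℕ} (M : Fin k → Matrix (Fin n) (Fin n) ℂ) (x y : Fin n),
    (List.ofFn M).prod x y = ∑ i : Fin (k + 1) → Fin n,
      if i 0 = x ∧ i (Fin.last k) = y then ∏ j : Fin k, M j (i j.castSucc) (i j.succ) else 0
  | 0, M, x, y => by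
    rw [← (Equiv.funUnique (Fin 1) (Fin n)).symm.sum_comp]
    simp [Matrix.one_apply, Finset.filter_and, Finset.filter_eq']
    split_ifs with h <;> simp [h]
  | k + 1, M, x, y => by
    rw [List.ofFn_succ, List.prod_cons, Matrix.mul_apply,
      ← (Fin.consEquiv fun _ : Fin (k + 2) => Fin n).sum_comp, Fintype.sum_prod_type]
    symm
    rw [Finset.sum_eq_single x _ (by simp)]
    · simp_rw [prod_ofFn_apply, Finset.mul_sum]
      rw [Finset.sum_comm (s := Finset.univ (α := Fin n))]
      refine Finset.sum_congr rfl fun i _ => ?_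
      symm
      rw [Finset.sum_eq_single (i 0)]
      · simp only [Fin.consEquiv_apply, Fin.cons_zero, true_and, ← Fin.succ_last, Fin.cons_succ,
          mul_ite, mul_zero, Fin.prod_univ_succ, Fin.castSucc_zero, ← Fin.succ_castSucc]
      · intro z _ hz
        rw [if_neg fun h => hz h.1.symm, mul_zero]
      · simp
    · intro z _ hz
      refine Finset.sum_eq_zero fun i _ => if_neg fun h => hz ?_
      simpa using h.1

lemma trace_prod_ofFn {n k : ℕ} (hk : 0 < k) (M : Fin k → Matrix (Fin n) (Fin n) ℂ) :
    (List.ofFn M).prod.trace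
      = ∑ i : Fin k → Fin n, ∏ j, M j (i j) (i (finRotate k j)) := by
  obtain ⟨k, rfl⟩ : ∃ l, k = l + 1 := ⟨k - 1, by omega⟩
  simp only [Matrix.trace, Matrix.diag_apply, prod_ofFn_apply]
  -- A path through the word has one index more than there are letters; the last one is split off,
  -- and the trace equates it with the first.
  rw [Finset.sum_comm, ← (Fin.snocEquiv fun _ : Fin (k + 1 + 1) => Fin n).sum_comp,
    Fintype.sum_prod_type, Finset.sum_comm]
  refine Finset.sum_congr rfl fun i _ => ?_
  have h0 : ∀ z : Fin n, (Fin.snocEquiv fun _ : Fin (k + 1 + 1) => Fin n) (z, i) 0 = i 0 := by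
    intro z
    exact Fin.snoc_castSucc (α := fun _ => Fin n) z i 0
  have hl : ∀ z : Fin n,
      (Fin.snocEquiv fun _ : Fin (k + 1 + 1) => Fin n) (z, i) (Fin.last (k + 1)) = z := by
    intro z
    exact Fin.snoc_last (α := fun _ => Fin n) z i
  have hc : ∀ (z : Fin n) (j : Fin (k + 1)),
      (Fin.snocEquiv fun _ : Fin (k + 1 + 1) => Fin n) (z, i) j.castSucc = i j := by
    intro z j
    exact Fin.snoc_castSucc (α := fun _ => Fin n) z i j
  simp only [h0, hl]
  rw [Finset.sum_eq_single (i 0)]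
  · rw [Finset.sum_eq_single (i 0) (fun x _ hx => if_neg fun h => hx h.1.symm) (by simp)]
    rw [if_pos ⟨rfl, rfl⟩]
    refine Finset.prod_congr rfl fun j _ => ?_
    rw [hc]
    congr 1
    refine Fin.lastCases ?_ (fun j => ?_) j
    · rw [Fin.succ_last, hl, finRotate_last]
    · rw [Fin.succ_castSucc, hc]
      congr 1
      ext
      rw [val_finRotate, if_neg]
      · simp
      · have := j.2
        simp only [Fin.val_castSucc]; omega
  · intro z _ hz
    exact Finset.sum_eq_zero fun x _ => if_neg fun h => hz (h.2.trans h.1.symm)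
  · simp

variable {A : Type*}

/-- The product of the factors `D^r (D^*)^s T^e` over a list of triples `((r, s), e)`. -/
def blockProd [Monoid A] [Star A] (D T : A) (L : List ((ℕ × ℕ) × Expo)) : A :=
  (L.map fun b => D ^ b.1.1 * star D ^ b.1.2 * b.2.app T).prod

/-- The contribution of an exponent to the pair (number of `D`, number of `D^*`). -/
def Expo.count : Expo → ℕ × ℕ
  | Expo.one => (1, 0)
  | Expo.star => (0, 1)

/-- The block decomposition of a word in `D` and `T`: the blocks `D^r (D^*)^s T^e`, and the
exponents `(r, s)` behind the last occurrence of `T`. -/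
def parse : List (Letter × Expo) → List ((ℕ × ℕ) × Expo) × (ℕ × ℕ)
  | [] => ([], 0)
  | (Letter.T, e) :: w => ((0, e) :: (parse w).1, (parse w).2)
  | (Letter.D, e) :: w =>
    match parse w with
    | ([], t) => ([], e.count + t)
    | (b :: L, t) => ((e.count + b.1, b.2) :: L, t)

lemma app_mul_pow_mul_pow [Monoid A] [Star A] {D : A} (h : Commute D (star D)) (e : Expo)
    (p : ℕ × ℕ) :
    e.app D * (D ^ p.1 * star D ^ p.2) = D ^ (e.count + p).1 * star D ^ (e.count + p).2 := by
  cases e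
  · simp [Expo.app, Expo.count, pow_add, mul_assoc]
  · simp only [Expo.app, Expo.count, Prod.fst_add, Prod.snd_add, zero_add, pow_add, pow_one]
    rw [← mul_assoc, (h.symm.pow_right _).eq, mul_assoc]

lemma starWord_cons {ι : Type*} [Monoid A] [Star A] (x : ι → A) (p : ι × Expo)
    (w : List (ι × Expo)) : starWord x (p :: w) = p.2.app (x p.1) * starWord x w := by
  simp [starWord]

/-- A new letter `D` or its adjoint is absorbed into the leading block, or into the trailing power
if no `T` follows; a letter `T` opens a block with trivial `D` part. -/
lemma starWord_eq_blockProd [Monoid A] [Star A] {D : A} (h : Commute D (star D)) (T : A) :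
    ∀ w : List (Letter × Expo), starWord (pair D T) w
      = blockProd D T (parse w).1 * (D ^ (parse w).2.1 * star D ^ (parse w).2.2)
  | [] => by simp [starWord, blockProd, parse]
  | (Letter.T, e) :: w => by
    rw [starWord_cons, starWord_eq_blockProd h T w, parse]
    simp [blockProd, pair, mul_assoc]
  | (Letter.D, e) :: w => by
    rw [starWord_cons, starWord_eq_blockProd h T w, parse]
    rcases parse w with ⟨_ | ⟨b, L⟩, t⟩
    · simpa [blockProd, pair] using app_mul_pow_mul_pow h e t
    · simp only [blockProd, List.map_cons, List.prod_cons, ← app_mul_pow_mul_pow h, pair]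
      simp only [mul_assoc]

lemma parse_replicate_append (e : Expo) (m : ℕ) (w : List (Letter × Expo)) (hw : (parse w).1 = []) :
    parse (List.replicate m (Letter.D, e) ++ w) = ([], m • e.count + (parse w).2) := by
  induction m with
  | zero => simp [← hw]
  | succ m ih =>
    rw [List.replicate_succ, List.cons_append, parse, ih]
    simp only [add_smul, one_smul]
    congr 1
    abel

lemma parse_replicate_append' (e : Expo) (m : ℕ) (w : List (Letter × Expo)) (b : (ℕ × ℕ) × Expo)
    (L : List ((ℕ × ℕ) × Expo)) (t : ℕ × ℕ) (hw : parse w = (b :: L, t)) :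
    parse (List.replicate m (Letter.D, e) ++ w) = ((m • e.count + b.1, b.2) :: L, t) := by
  induction m with
  | zero => simp [hw]
  | succ m ih =>
    rw [List.replicate_succ, List.cons_append, parse, ih]
    simp only [add_smul, one_smul]
    congr 3
    abel

lemma parse_wordD (a b : ℕ) : parse (wordD a b) = ([], (a, b)) := by
  have h : parse (List.replicate b (Letter.D, Expo.star)) = ([], (0, b)) := by
    have := parse_replicate_append Expo.star b [] rfl
    simpa [Expo.count, parse] using this
  rw [wordD, parse_replicate_append _ _ _ (by rw [h]), h]
  simp [Expo.count]

lemma parse_wordDT : ∀ {k : ℕ} (a b : Fin k → ℕ) (ε : Fin k → Expo),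
    parse (wordDT a b ε) = (List.ofFn fun j => ((a j, b j), ε j), 0)
  | 0, a, b, ε => by simp [wordDT, parse]
  | k + 1, a, b, ε => by
    have ih := parse_wordDT (fun j => a j.succ) (fun j => b j.succ) (fun j => ε j.succ)
    have h : wordDT a b ε = List.replicate (a 0) (Letter.D, Expo.one) ++
        (List.replicate (b 0) (Letter.D, Expo.star) ++ ((Letter.T, ε 0) ::
          wordDT (fun j => a j.succ) (fun j => b j.succ) (fun j => ε j.succ))) := by
      simp [wordDT, wordD, List.ofFn_succ]
    have h₁ : parse ((Letter.T, ε 0) ::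
        wordDT (fun j => a j.succ) (fun j => b j.succ) (fun j => ε j.succ))
        = ((0, ε 0) :: List.ofFn fun j => ((a j.succ, b j.succ), ε j.succ), 0) := by
      rw [parse, ih]
    rw [h, parse_replicate_append' _ _ _ _ _ _ (parse_replicate_append' _ _ _ _ _ _ h₁)]
    simp [Expo.count, List.ofFn_succ]

/-- The limit of the moments of the word with blocks `L`. -/
noncomputable def limitBlocks (μ : Measure ℂ) (L : List ((ℕ × ℕ) × Expo)) : ℂ :=
  limitDT μ (k := L.length) (fun j => (L.get j).1.1) (fun j => (L.get j).1.2) fun j => (L.get j).2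

lemma limitBlocks_ofFn (μ : Measure ℂ) {k : ℕ} (a b : Fin k → ℕ) (ε : Fin k → Expo) :
    limitBlocks μ (List.ofFn fun j => ((a j, b j), ε j)) = limitDT μ a b ε := by
  -- The list is generalized so that its length equation can be eliminated, which removes the casts
  -- between `Fin` types.
  have key : ∀ (L : List ((ℕ × ℕ) × Expo)) (h : L.length = k),
      (∀ j : Fin L.length, L.get j = ((a (j.cast h), b (j.cast h)), ε (j.cast h))) →
      limitBlocks μ L = limitDT μ a b ε := by
    rintro L rfl h
    simp only [limitBlocks, h]
    rfl
  exact key _ (by simp) fun j => by simp [Fin.cast]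

/-- The blocks of a word up to cyclic rotation. -/
def cyclicBlocks : List ((ℕ × ℕ) × Expo) × (ℕ × ℕ) → List ((ℕ × ℕ) × Expo)
  | ([], _) => []
  | (b :: L, t) => (t + b.1, b.2) :: L

/-- The limit moment of a word in `D` and `T`. -/
noncomputable def limitWord (μ : Measure ℂ) (w : List (Letter × Expo)) : ℂ :=
  if (parse w).1 = [] then starMoment μ (parse w).2.1 (parse w).2.2
  else limitBlocks μ (cyclicBlocks (parse w))

lemma limitWord_wordD (μ : Measure ℂ) (a b : ℕ) :
    limitWord μ (wordD a b) = starMoment μ a b := by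
  simp [limitWord, parse_wordD]

lemma limitWord_wordDT (μ : Measure ℂ) {k : ℕ} (hk : 1 ≤ k) (a b : Fin k → ℕ)
    (ε : Fin k → Expo) : limitWord μ (wordDT a b ε) = limitDT μ a b ε := by
  obtain ⟨k, rfl⟩ : ∃ l, k = l + 1 := ⟨k - 1, by omega⟩
  rw [limitWord, parse_wordDT, if_neg (by simp [List.ofFn_succ]), ← limitBlocks_ofFn]
  congr 1
  simp [List.ofFn_succ, cyclicBlocks]

lemma trace_starWord_of_nil {n : ℕ} {D T : Matrix (Fin n) (Fin n) ℂ} (h : Commute D (star D))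
    (w : List (Letter × Expo)) (hw : (parse w).1 = []) :
    (starWord (pair D T) w).trace = (D ^ (parse w).2.1 * star D ^ (parse w).2.2).trace := by
  rw [starWord_eq_blockProd h, hw]
  simp [blockProd]

/-- Cyclicity moves the trailing power to the front, where it commutes into the first block. -/
lemma trace_starWord_of_ne_nil {n : ℕ} {D T : Matrix (Fin n) (Fin n) ℂ} (h : Commute D (star D))
    (w : List (Letter × Expo)) (hw : (parse w).1 ≠ []) :
    (starWord (pair D T) w).trace = (blockProd D T (cyclicBlocks (parse w))).trace := by
  rw [starWord_eq_blockProd h]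
  rcases hp : parse w with ⟨_ | ⟨b, L⟩, t⟩
  · exact absurd (by rw [hp]) hw
  · rw [Matrix.trace_mul_comm]
    simp only [cyclicBlocks, blockProd, List.map_cons, List.prod_cons, Prod.fst_add,
      Prod.snd_add, pow_add]
    congr 1
    have hc : star D ^ t.2 * D ^ b.1.1 = D ^ b.1.1 * star D ^ t.2 :=
      ((h.symm.pow_left _).pow_right _).eq
    simp only [mul_assoc]
    rw [← mul_assoc (star D ^ t.2) (D ^ b.1.1), hc]
    simp only [mul_assoc]

lemma blockProd_eq_prod_ofFn [Monoid A] [Star A] (D T : A) (L : List ((ℕ × ℕ) × Expo)) :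
    blockProd D T L = (List.ofFn fun j : Fin L.length =>
      D ^ (L.get j).1.1 * star D ^ (L.get j).1.2 * (L.get j).2.app T).prod := by
  rw [blockProd]
  congr 1
  conv_lhs => rw [← List.ofFn_get L, List.map_ofFn]
  rfl

end Words

/-! ### Random matrices with finite moments -/

section FiniteMoments

variable {Ω : Type*} [MeasurableSpace Ω] {P : Measure Ω}

/-- All absolute moments of `f` are finite. -/
def HasMoments (P : Measure Ω) (f : Ω → ℂ) : Prop :=
  ∀ p : ℕ, MemLp f p P

lemma HasMoments.integrable {f : Ω → ℂ} (hf : HasMoments P f) : Integrable f P := by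
  have := hf 1
  rwa [Nat.cast_one, memLp_one_iff_integrable] at this

lemma HasMoments.add {f g : Ω → ℂ} (hf : HasMoments P f) (hg : HasMoments P g) :
    HasMoments P (fun ω => f ω + g ω) := fun p => (hf p).add (hg p)

/-- Hölder with both exponents 2p: finite moments of every order, unlike those of a fixed order,
survive products. -/
lemma HasMoments.mul {f g : Ω → ℂ} (hf : HasMoments P f) (hg : HasMoments P g) :
    HasMoments P (fun ω => f ω * g ω) := by
  intro p
  have : ENNReal.HolderTriple ((2 * p : ℕ) : ENNReal) ((2 * p : ℕ) : ENNReal) p := by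
    refine ⟨?_⟩
    push_cast
    rw [ENNReal.mul_inv (by simp) (by simp), ← add_mul, ENNReal.inv_two_add_inv_two, one_mul]
  exact (hg (2 * p)).mul' (hf (2 * p))

lemma HasMoments.star {f : Ω → ℂ} (hf : HasMoments P f) :
    HasMoments P (fun ω => star (f ω)) := fun p => (hf p).star

lemma HasMoments.const [IsFiniteMeasure P] (c : ℂ) : HasMoments P (fun _ => c) :=
  fun _ => memLp_const c

lemma HasMoments.congr {f g : Ω → ℂ} (hf : HasMoments P f) (h : f =ᵐ[P] g) : HasMoments P g :=
  fun p => (memLp_congr_ae h).1 (hf p)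

lemma HasMoments.sum {ι : Type*} (s : Finset ι) {f : ι → Ω → ℂ} (hf : ∀ i, HasMoments P (f i)) :
    HasMoments P (fun ω => ∑ i ∈ s, f i ω) := fun p => memLp_finsetSum s fun i _ => hf i p

lemma HasMoments.prod [IsFiniteMeasure P] {ι : Type*} (s : Finset ι) {f : ι → Ω → ℂ}
    (hf : ∀ i, HasMoments P (f i)) : HasMoments P (fun ω => ∏ i ∈ s, f i ω) := by
  classical
  induction s using Finset.induction_on with
  | empty => simpa using HasMoments.const 1
  | insert i s hi ih => simpa [Finset.prod_insert hi] using (hf i).mul ih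

lemma HasMoments.pow [IsFiniteMeasure P] {f : Ω → ℂ} (hf : HasMoments P f) (m : ℕ) :
    HasMoments P (fun ω => f ω ^ m) := by
  simpa using HasMoments.prod (Finset.range m) (f := fun _ => f) fun _ => hf

lemma HasMoments.app {f : Ω → ℂ} (hf : HasMoments P f) (e : Expo) :
    HasMoments P (fun ω => e.app (f ω)) := by
  cases e
  · exact hf
  · exact hf.star

lemma IsComplexGaussian.hasMoments {a : Ω → ℂ} {v : ℝ≥0} (h : IsComplexGaussian P a v) :
    HasMoments P a := by
  intro p
  have key : ∀ f : Ω → ℝ, HasLaw f (gaussianReal 0 (v / 2)) P →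
      MemLp (fun ω => (f ω : ℂ)) p P := by
    intro f hf
    have h₁ : MemLp id (p : ENNReal) (P.map f) := by
      rw [hf.map_eq]; exact memLp_id_gaussianReal' _ (ENNReal.natCast_ne_top p)
    exact Complex.ofRealCLM.comp_memLp' ((memLp_map_measure_iff h₁.1 hf.aemeasurable).1 h₁)
  have h₁ := (key _ h.1).add ((key _ h.2.1).mul_const Complex.I)
  refine (memLp_congr_ae (Eventually.of_forall fun ω => ?_)).1 h₁
  exact Complex.re_add_im (a ω)

lemma hasMoments_starWord [IsFiniteMeasure P] {n : ℕ} {ι : Type*}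
    {X : ι → Ω → Matrix (Fin n) (Fin n) ℂ} (hX : ∀ l x y, HasMoments P (fun ω => X l ω x y))
    (w : List (ι × Expo)) :
    ∀ x y, HasMoments P (fun ω => starWord (fun l => X l ω) w x y) := by
  induction w with
  | nil => exact fun x y => HasMoments.const _
  | cons p w ih =>
    intro x y
    simp only [starWord_cons, Matrix.mul_apply]
    refine HasMoments.sum _ fun z => HasMoments.mul ?_ (ih z y)
    rcases p with ⟨l, _ | _⟩
    · exact hX l x z
    · exact (hX l z x).star

lemma integrable_normTrace_starWord [IsFiniteMeasure P] {n : ℕ} {ι : Type*}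
    {X : ι → Ω → Matrix (Fin n) (Fin n) ℂ} (hX : ∀ l x y, HasMoments P (fun ω => X l ω x y))
    (w : List (ι × Expo)) :
    Integrable (fun ω => normTrace (starWord (fun l => X l ω) w)) P :=
  ((HasMoments.const (P := P) _).mul
    (HasMoments.sum _ fun x => hasMoments_starWord hX w x x)).integrable

lemma IsUTGRM.hasMoments [IsFiniteMeasure P] {n : ℕ} {T : Ω → Matrix (Fin n) (Fin n) ℂ} {v : ℝ≥0}
    (hT : IsUTGRM P T v) (x y : Fin n) : HasMoments P (fun ω => T ω x y) := by
  by_cases h : x < y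
  · exact (hT.gaussian x y h).hasMoments
  · refine (HasMoments.const 0).congr ?_
    filter_upwards [hT.lower_zero x y (not_lt.1 h)] with ω hω
    exact hω.symm

variable {μ : Measure ℂ} {R : ℝ}

lemma IsIIDDiagonal.ae_bound {n : ℕ} {D : Ω → Matrix (Fin n) (Fin n) ℂ}
    (hD : IsIIDDiagonal P D μ) (hR : ∀ᵐ z ∂μ, ‖z‖ ≤ R) (x : Fin n) :
    ∀ᵐ ω ∂P, ‖D ω x x‖ ≤ R := by
  rw [← (hD.law x).map_eq] at hR
  exact ae_of_ae_map (hD.law x).aemeasurable hR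

lemma IsIIDDiagonal.hasMoments [IsFiniteMeasure P] {n : ℕ} {D : Ω → Matrix (Fin n) (Fin n) ℂ}
    (hD : IsIIDDiagonal P D μ) (hR : ∀ᵐ z ∂μ, ‖z‖ ≤ R) (x y : Fin n) :
    HasMoments P (fun ω => D ω x y) := by
  by_cases h : x = y
  · subst h
    exact fun p => MemLp.of_bound (hD.law x).aemeasurable.aestronglyMeasurable R (hD.ae_bound hR x)
  · refine (HasMoments.const 0).congr ?_
    filter_upwards [hD.off_diag x y h] with ω hω
    exact hω.symm

lemma IsIIDDiagonal.ae_eq_diagonal {n : ℕ} {D : Ω → Matrix (Fin n) (Fin n) ℂ}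
    (hD : IsIIDDiagonal P D μ) : ∀ᵐ ω ∂P, D ω = Matrix.diagonal fun x => D ω x x := by
  have h : ∀ᵐ ω ∂P, ∀ x y, x ≠ y → D ω x y = 0 := by
    simp only [ae_all_iff]
    exact hD.off_diag
  filter_upwards [h] with ω hω
  ext x y
  by_cases hxy : x = y
  · subst hxy; simp
  · rw [hω x y hxy, Matrix.diagonal_apply_ne _ hxy]

end FiniteMoments

/-! ### Expectations of the summands of a trace -/

section Expectation

variable {Ω : Type*} [MeasurableSpace Ω] {P : Measure Ω} {n k : ℕ}

/-- The position of the entry of `T` which occurs in `(T^{ε(j)})_{i(j), i(j+1)}`. -/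
def entryPos (ε : Fin k → Expo) (i : Fin k → Fin n) (j : Fin k) : Fin n × Fin n :=
  match ε j with
  | Expo.one => (i j, i (finRotate k j))
  | Expo.star => (i (finRotate k j), i j)

lemma app_apply_eq (ε : Fin k → Expo) (i : Fin k → Fin n) (j : Fin k)
    (T : Matrix (Fin n) (Fin n) ℂ) :
    (ε j).app T (i j) (i (finRotate k j))
      = (ε j).app (T (entryPos ε i j).1 (entryPos ε i j).2) := by
  unfold entryPos
  cases ε j <;> rfl

/-- Opposite exponents reverse the index pair, so equal entries mean two gluing equations at `j`;
the second is the first one at `σ j`. -/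
lemma entryPos_partner_iff {σ : Fin k → Fin k} (hσ : IsPairing σ) {ε : Fin k → Expo}
    (hc : IsCompatible ε σ) (i : Fin k → Fin n) :
    (∀ j, entryPos ε i (σ j) = entryPos ε i j) ↔ ∀ j, i j = i (finRotate k (σ j)) := by
  have key : ∀ j, entryPos ε i (σ j) = entryPos ε i j ↔
      i j = i (finRotate k (σ j)) ∧ i (σ j) = i (finRotate k j) := by
    intro j
    have := hc j
    unfold entryPos
    cases h : ε j <;> cases h' : ε (σ j) <;> simp_all [Prod.ext_iff, eq_comm, and_comm]
  constructor
  · exact fun h j => ((key j).1 (h j)).1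
  · intro h j
    refine (key j).2 ⟨h j, ?_⟩
    have := h (σ j)
    rwa [(hσ j).2] at this

open Classical in
/-- The pairings, crossing or not, that are compatible with `ε`. -/
noncomputable def compatiblePairings (ε : Fin k → Expo) : Finset (Fin k → Fin k) :=
  Finset.univ.filter fun σ => IsPairing σ ∧ IsCompatible ε σ

open Classical in
lemma integral_prod_entries [IsProbabilityMeasure P] {T : Ω → Matrix (Fin n) (Fin n) ℂ} {v : ℝ≥0}
    (hv : v ≠ 0) (hT : IsUTGRM P T v) (ε : Fin k → Expo) (i : Fin k → Fin n) :
    ∫ ω, ∏ j, (ε j).app (T ω (entryPos ε i j).1 (entryPos ε i j).2) ∂P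
      = ∑ σ ∈ compatiblePairings ε, if (∀ j, i j = i (finRotate k (σ j))) ∧
          ∀ j, (entryPos ε i j).1 < (entryPos ε i j).2 then (v : ℂ) ^ (k / 2) else 0 := by
  by_cases hup : ∀ j, (entryPos ε i j).1 < (entryPos ε i j).2
  · have h := wick_formula hv (fun p : {p : Fin n × Fin n // p.1 < p.2} =>
      hT.gaussian p.1.1 p.1.2 p.2) hT.indep ε (fun j => ⟨entryPos ε i j, hup j⟩)
    simp only [Subtype.mk.injEq] at h
    rw [h]
    simp only [hup, implies_true, and_true]
    rw [← Finset.sum_filter, Finset.sum_const, nsmul_eq_mul, mul_comm, Nat.card_eq_fintype_card,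
      Fintype.card_subtype, compatiblePairings, Finset.filter_filter]
    congr 3
    ext σ
    simp only [Finset.mem_filter, Finset.mem_univ, true_and]
    constructor
    · exact fun h => ⟨⟨h.1, h.2.1⟩, (entryPos_partner_iff h.1 h.2.1 i).1 h.2.2⟩
    · exact fun h => ⟨h.1.1, h.1.2, (entryPos_partner_iff h.1.1 h.1.2 i).2 h.2⟩
  -- An entry on or below the diagonal vanishes almost surely, and with it the product.
  · simp only [hup, and_false, if_false, Finset.sum_const_zero]
    push Not at hup
    obtain ⟨j, hj⟩ := hup
    refine integral_eq_zero_of_ae ?_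
    filter_upwards [hT.lower_zero _ _ hj] with ω hω
    refine Finset.prod_eq_zero (Finset.mem_univ j) ?_
    rw [hω]
    cases ε j <;> simp [Expo.app]

/-- The product of the moments of `μ` over the values of the labeling `i`. -/
noncomputable def labelMoment {ι : Type*} [Fintype ι] [DecidableEq ι] (μ : Measure ℂ)
    (a b : Fin k → ℕ) (i : Fin k → ι) : ℂ :=
  ∏ x, starMoment μ (∑ j with i j = x, a j) (∑ j with i j = x, b j)

variable {μ : Measure ℂ} {R : ℝ}

lemma integral_prod_diagonal {D : Ω → Matrix (Fin n) (Fin n) ℂ} (hD : IsIIDDiagonal P D μ)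
    (a b : Fin k → ℕ) (i : Fin k → Fin n) :
    ∫ ω, ∏ j, (D ω (i j) (i j) ^ a j * conj (D ω (i j) (i j)) ^ b j) ∂P = labelMoment μ a b i := by
  have hprod : ∀ ω, ∏ j, (D ω (i j) (i j) ^ a j * conj (D ω (i j) (i j)) ^ b j)
      = ∏ x, (D ω x x ^ (∑ j with i j = x, a j) * conj (D ω x x) ^ (∑ j with i j = x, b j)) := by
    intro ω
    rw [← Finset.prod_fiberwise Finset.univ i]
    refine Finset.prod_congr rfl fun x _ => ?_
    rw [← Finset.prod_pow_eq_pow_sum, ← Finset.prod_pow_eq_pow_sum, ← Finset.prod_mul_distrib]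
    refine Finset.prod_congr rfl fun j hj => ?_
    rw [(Finset.mem_filter.1 hj).2]
  have hmeas : ∀ r s : ℕ, Continuous fun z : ℂ => z ^ r * conj z ^ s := fun r s => by fun_prop
  simp_rw [hprod]
  rw [hD.indep.integral_fun_prod_comp (f := fun x z =>
    z ^ (∑ j with i j = x, a j) * conj z ^ (∑ j with i j = x, b j))
    (fun x => (hD.law x).aemeasurable) fun x => (hmeas _ _).aestronglyMeasurable, labelMoment]
  refine Finset.prod_congr rfl fun x _ => ?_
  rw [starMoment, ← (hD.law x).map_eq, integral_map (hD.law x).aemeasurable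
    (hmeas _ _).aestronglyMeasurable]

lemma norm_starMoment_le [IsProbabilityMeasure μ] (hR : ∀ᵐ z ∂μ, ‖z‖ ≤ R) (r s : ℕ) :
    ‖starMoment μ r s‖ ≤ R ^ (r + s) := by
  have h := norm_integral_le_of_norm_le_const (μ := μ) (f := fun z => z ^ r * conj z ^ s)
    (C := R ^ (r + s)) (by
      filter_upwards [hR] with z hz
      rw [norm_mul, norm_pow, norm_pow, RCLike.norm_conj, ← pow_add]
      exact pow_le_pow_left₀ (norm_nonneg z) hz _)
  simpa [starMoment] using h

/-- The exponents sum to the same total for every labeling, so the bound is uniform in `n` and `i`.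
-/
lemma norm_labelMoment_le [IsProbabilityMeasure μ] (hR : ∀ᵐ z ∂μ, ‖z‖ ≤ R) (a b : Fin k → ℕ)
    (i : Fin k → Fin n) : ‖labelMoment μ a b i‖ ≤ R ^ ∑ j, (a j + b j) := by
  rw [labelMoment, norm_prod]
  refine (Finset.prod_le_prod (fun _ _ => norm_nonneg _)
    fun x _ => norm_starMoment_le hR _ _).trans_eq ?_
  rw [Finset.prod_pow_eq_pow_sum]
  congr 1
  rw [← Finset.sum_fiberwise Finset.univ i]
  exact Finset.sum_congr rfl fun x _ => Finset.sum_add_distrib.symm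

open Classical in
-- Distinct vertices keep distinct labels, and unused labels contribute the moment of order (0, 0),
-- which is 1.
lemma labelMoment_comp_of_injective [IsProbabilityMeasure μ] {σ : Fin k → Fin k}
    (a b : Fin k → ℕ) {f : QVert σ → Fin n} (hf : Function.Injective f) :
    labelMoment μ a b (fun j => f (QVert.mk σ j)) = weight μ a b σ := by
  rw [labelMoment, weight]
  symm
  refine Fintype.prod_of_injective f hf _ _ (fun x hx => ?_) fun w => ?_
  · have h : (Finset.univ.filter fun j => f (QVert.mk σ j) = x) = ∅ := by
      rw [Finset.filter_eq_empty_iff]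
      exact fun j _ h => hx ⟨_, h⟩
    rw [h]
    simp [starMoment]
  · simp only [hf.eq_iff]

end Expectation

/-! ### The limit of the joint moments -/

section Limit

variable {Ω : Type*} [MeasurableSpace Ω] {P : Measure Ω} {n k : ℕ} {μ : Measure ℂ} {R : ℝ}

lemma diagonal_word_apply (d : Fin n → ℂ) (X : Matrix (Fin n) (Fin n) ℂ) (r s : ℕ)
    (x y : Fin n) :
    (Matrix.diagonal d ^ r * star (Matrix.diagonal d) ^ s * X) x y
      = d x ^ r * conj (d x) ^ s * X x y := by
  rw [Matrix.star_eq_conjTranspose, Matrix.diagonal_conjTranspose, Matrix.diagonal_pow,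
    Matrix.diagonal_pow, Matrix.diagonal_mul_diagonal, Matrix.diagonal_mul]
  simp

open Classical in
/-- The sum over the labelings of the vertices of the quotient graph that increase along the
arrows, of the corresponding moments of `μ`. -/
noncomputable def labelSum (μ : Measure ℂ) (a b : Fin k → ℕ) (ε : Fin k → Expo)
    (σ : Fin k → Fin k) (n : ℕ) : ℂ :=
  ∑ f : QVert σ → Fin n with ∀ w w', arrow ε σ w w' → f w < f w',
    labelMoment μ a b fun j => f (QVert.mk σ j)

open Classical in
-- Index walks constant on glued vertices are labelings of the quotient, and strict upper
-- triangularity of the entries becomes monotonicity along arrows.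
lemma sum_glued_labelings (μ : Measure ℂ) (a b : Fin k → ℕ) (ε : Fin k → Expo)
    (σ : Fin k → Fin k) (n : ℕ) :
    ∑ i : Fin k → Fin n with (∀ j, i j = i (finRotate k (σ j))) ∧
      ∀ j, (entryPos ε i j).1 < (entryPos ε i j).2, labelMoment μ a b i
      = labelSum μ a b ε σ n := by
  have harrow : ∀ f : QVert σ → Fin n, (∀ w w', arrow ε σ w w' → f w < f w') ↔
      ∀ j, (entryPos ε (fun j => f (QVert.mk σ j)) j).1
        < (entryPos ε (fun j => f (QVert.mk σ j)) j).2 := by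
    intro f
    constructor
    · intro h j
      unfold entryPos
      cases hj : ε j
      · exact h _ _ ⟨j, Or.inl ⟨hj, rfl, rfl⟩⟩
      · exact h _ _ ⟨j, Or.inr ⟨hj, rfl, rfl⟩⟩
    · rintro h w w' ⟨j, ⟨hj, rfl, rfl⟩ | ⟨hj, rfl, rfl⟩⟩ <;>
      · have := h j
        rw [entryPos, hj] at this
        exact this
  symm
  refine Finset.sum_bij (fun f _ j => f (QVert.mk σ j)) (fun f hf => ?_) (fun f _ f' _ h => ?_)
    (fun i hi => ?_) fun f _ => rfl
  · simp only [Finset.mem_filter, Finset.mem_univ, true_and] at hf ⊢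
    exact ⟨fun j => by rw [mk_finRotate_partner], (harrow f).1 hf⟩
  · funext w
    obtain ⟨j, rfl⟩ := QVert.mk_surjective σ w
    exact congrFun h j
  · simp only [Finset.mem_filter, Finset.mem_univ, true_and] at hi
    exact ⟨QVert.lift i hi.1, by
      simp only [Finset.mem_filter, Finset.mem_univ, true_and]
      exact (harrow _).2 hi.2, rfl⟩

lemma tau_word_eq [IsProbabilityMeasure P] {v : ℝ≥0} (hv : v ≠ 0) (hk : 0 < k)
    {D T : Ω → Matrix (Fin n) (Fin n) ℂ} (hR : ∀ᵐ z ∂μ, ‖z‖ ≤ R) (hD : IsIIDDiagonal P D μ)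
    (hT : IsUTGRM P T v) (hDT : IndepMatrices P D T) (a b : Fin k → ℕ) (ε : Fin k → Expo) :
    tau P (fun ω => (List.ofFn fun j =>
        D ω ^ a j * star (D ω) ^ b j * (ε j).app (T ω)).prod)
      = (n : ℂ)⁻¹ * (v : ℂ) ^ (k / 2) *
        ∑ σ ∈ compatiblePairings ε, labelSum μ a b ε σ n := by
  classical
  set FD : (Fin k → Fin n) → (Fin n × Fin n → ℂ) → ℂ := fun i X =>
    ∏ j, (X (i j, i j) ^ a j * conj (X (i j, i j)) ^ b j) with hFD
  set FT : (Fin k → Fin n) → (Fin n × Fin n → ℂ) → ℂ := fun i X =>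
    ∏ j, (ε j).app (X (entryPos ε i j)) with hFT
  set XD : Ω → Fin n × Fin n → ℂ := fun ω p => D ω p.1 p.2
  set XT : Ω → Fin n × Fin n → ℂ := fun ω p => T ω p.1 p.2
  have hFDm : ∀ i, Measurable (FD i) := fun i =>
    (by simp only [hFD]; fun_prop : Continuous (FD i)).measurable
  have hFTm : ∀ i, Measurable (FT i) := fun i => by
    refine (continuous_finsetProd _ fun j _ => ?_ : Continuous (FT i)).measurable
    cases ε j
    · exact continuous_apply _
    · exact (continuous_apply _).star
  have hmD : ∀ i, HasMoments P (fun ω => FD i (XD ω)) := fun i =>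
    HasMoments.prod _ fun j => ((hD.hasMoments hR (i j) (i j)).pow _).mul
      ((hD.hasMoments hR (i j) (i j)).star.pow _)
  have hmT : ∀ i, HasMoments P (fun ω => FT i (XT ω)) := fun i =>
    HasMoments.prod _ fun j => (hT.hasMoments _ _).app _
  have hexp : ∀ᵐ ω ∂P, normTrace (List.ofFn fun j =>
        D ω ^ a j * star (D ω) ^ b j * (ε j).app (T ω)).prod
      = (n : ℂ)⁻¹ * ∑ i : Fin k → Fin n, FD i (XD ω) * FT i (XT ω) := by
    filter_upwards [hD.ae_eq_diagonal] with ω hω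
    rw [normTrace, trace_prod_ofFn hk]
    congr 1
    refine Finset.sum_congr rfl fun i _ => ?_
    rw [← Finset.prod_mul_distrib]
    refine Finset.prod_congr rfl fun j _ => ?_
    rw [hω, diagonal_word_apply, app_apply_eq]
  -- Independence of the two matrices factors the summand; the `T` factor is evaluated by Wick's
  -- formula, the `D` factor by independence of the diagonal entries.
  have hint : ∀ i, ∫ ω, FD i (XD ω) * FT i (XT ω) ∂P = labelMoment μ a b i *
      ∑ σ ∈ compatiblePairings ε, if (∀ j, i j = i (finRotate k (σ j))) ∧
          ∀ j, (entryPos ε i j).1 < (entryPos ε i j).2 then (v : ℂ) ^ (k / 2) else 0 := by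
    intro i
    have hind : IndepFun (fun ω => FD i (XD ω)) (fun ω => FT i (XT ω)) P :=
      IndepFun.comp (φ := FD i) (ψ := FT i) hDT (hFDm i) (hFTm i)
    rw [hind.integral_fun_mul_eq_mul_integral (hmD i 1).1 (hmT i 1).1,
      ← integral_prod_entries hv hT, ← integral_prod_diagonal hD]
  rw [tau, integral_congr_ae hexp, integral_const_mul,
    integral_finsetSum _ fun i _ => ((hmD i).mul (hmT i)).integrable, mul_assoc]
  congr 1
  simp_rw [hint, Finset.mul_sum]
  rw [Finset.sum_comm]
  refine Finset.sum_congr rfl fun σ _ => ?_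
  rw [← sum_glued_labelings, Finset.mul_sum, Finset.sum_filter]
  refine Finset.sum_congr rfl fun i _ => ?_
  split_ifs <;> ring

/-- The exponent k/2 + 1 collects one power from the normalized trace and k/2 from the variance 1/n;
it equals the vertex count for non-crossing σ and exceeds it otherwise. -/
lemma tendsto_labelSum [IsProbabilityMeasure μ] (hR : ∀ᵐ z ∂μ, ‖z‖ ≤ R) (hk : 0 < k)
    (a b : Fin k → ℕ) {ε : Fin k → Expo} {σ : Fin k → Fin k} (hσ : IsPairing σ)
    [Decidable (IsNonCrossing σ)] :
    Tendsto (fun n : ℕ => ((n : ℂ) ^ (k / 2 + 1))⁻¹ * labelSum μ a b ε σ n) atTop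
      (𝓝 (if IsNonCrossing σ then
        1 / ((k / 2 + 1).factorial : ℂ) * (weight μ a b σ * (NTO ε σ : ℂ)) else 0)) := by
  classical
  split_ifs with hn
  · have h := tendsto_sum_labelings (arrow ε σ)
      (fun n f => labelMoment μ a b fun j => f (QVert.mk σ j)) (R ^ ∑ j, (a j + b j))
      (weight μ a b σ) (fun n f => norm_labelMoment_le hR a b _)
      fun n f hf => labelMoment_comp_of_injective a b hf
    rw [card_QVert_of_nonCrossing hk hσ hn] at h
    have heq : 1 / ((k / 2 + 1).factorial : ℂ) * (weight μ a b σ * (NTO ε σ : ℂ))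
        = weight μ a b σ * (NTO ε σ : ℂ) / ((k / 2 + 1).factorial : ℂ) := by ring
    rw [heq]
    exact h
  · exact tendsto_sum_labelings_of_card_lt (arrow ε σ)
      (fun n f => labelMoment μ a b fun j => f (QVert.mk σ j)) (R ^ ∑ j, (a j + b j))
      (fun n f => norm_labelMoment_le hR a b _)
      (Nat.lt_succ_of_le (card_QVert_le_of_crossing hk hσ hn))

lemma tendsto_sum_labelSum [IsProbabilityMeasure μ] (hR : ∀ᵐ z ∂μ, ‖z‖ ≤ R) (hk : 0 < k)
    (a b : Fin k → ℕ) (ε : Fin k → Expo) :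
    Tendsto (fun n : ℕ => (n : ℂ)⁻¹ * (((1 / (n : ℝ≥0) : ℝ≥0) : ℝ) : ℂ) ^ (k / 2) *
      ∑ σ ∈ compatiblePairings ε, labelSum μ a b ε σ n) atTop (𝓝 (limitDT μ a b ε)) := by
  classical
  have h := tendsto_finsetSum (compatiblePairings ε) fun σ hσ =>
    tendsto_labelSum hR hk a b (ε := ε) (Finset.mem_filter.1 hσ).2.1
  have hl : limitDT μ a b ε = ∑ σ ∈ compatiblePairings ε, if IsNonCrossing σ then
        1 / ((k / 2 + 1).factorial : ℂ) * (weight μ a b σ * (NTO ε σ : ℂ)) else 0 := by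
    rw [limitDT, Finset.mul_sum, ← Finset.sum_filter]
    refine Finset.sum_congr ?_ fun _ _ => rfl
    ext σ
    simp only [compatibleNCP, compatiblePairings, Finset.mem_filter, Finset.mem_univ, true_and]
    tauto
  rw [hl]
  refine h.congr fun n => ?_
  rw [← Finset.mul_sum]
  congr 1
  push_cast
  rw [pow_succ, mul_inv, one_div, inv_pow, mul_comm]

/-- Each diagonal entry has law μ, so the identity is exact for every n ≥ 1. -/
lemma tau_diagonal_word [IsProbabilityMeasure P] (hn : 0 < n)
    {D : Ω → Matrix (Fin n) (Fin n) ℂ} (hR : ∀ᵐ z ∂μ, ‖z‖ ≤ R) (hD : IsIIDDiagonal P D μ)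
    (r s : ℕ) : tau P (fun ω => D ω ^ r * star (D ω) ^ s) = starMoment μ r s := by
  have hexp : ∀ᵐ ω ∂P, normTrace (D ω ^ r * star (D ω) ^ s)
      = (n : ℂ)⁻¹ * ∑ x, (D ω x x ^ r * conj (D ω x x) ^ s) := by
    filter_upwards [hD.ae_eq_diagonal] with ω hω
    rw [normTrace, Matrix.trace]
    congr 1
    refine Finset.sum_congr rfl fun x _ => ?_
    have := diagonal_word_apply (fun x => D ω x x) 1 r s x x
    rw [mul_one, ← hω] at this
    simpa using this
  have hmeas : Continuous fun z : ℂ => z ^ r * conj z ^ s := by fun_prop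
  have hx : ∀ x, ∫ ω, D ω x x ^ r * conj (D ω x x) ^ s ∂P = starMoment μ r s := fun x => by
    rw [starMoment, ← (hD.law x).map_eq, integral_map (hD.law x).aemeasurable
      hmeas.aestronglyMeasurable]
  have hm : ∀ x, HasMoments P (fun ω => D ω x x ^ r * conj (D ω x x) ^ s) := fun x =>
    ((hD.hasMoments hR x x).pow _).mul ((hD.hasMoments hR x x).star.pow _)
  rw [tau, integral_congr_ae hexp, integral_const_mul,
    integral_finsetSum _ fun x _ => (hm x).integrable]
  simp_rw [hx]
  rw [Finset.sum_const, Finset.card_univ, Fintype.card_fin, nsmul_eq_mul, ← mul_assoc,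
    inv_mul_cancel₀ (by exact_mod_cast hn.ne'), one_mul]

end Limit

/-! ### Convergence of all words, and the triangular matrix alone -/

section Convergence

variable {Ω : ℕ → Type*} [∀ n, MeasurableSpace (Ω n)] {P : (n : ℕ) → Measure (Ω n)}
  [∀ n, IsProbabilityMeasure (P n)] {μ : Measure ℂ} {R : ℝ}

lemma pair_eq_fun {A : Type*} {Ω : Type*} (D T : Ω → A) (ω : Ω) :
    pair (D ω) (T ω) = fun l => pair D T l ω := by
  funext l; cases l <;> rfl

lemma integrable_word {Ω : Type*} [MeasurableSpace Ω] {P : Measure Ω} [IsProbabilityMeasure P]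
    {n : ℕ} {v : ℝ≥0} {D T : Ω → Matrix (Fin n) (Fin n) ℂ} (hR : ∀ᵐ z ∂μ, ‖z‖ ≤ R)
    (hD : IsIIDDiagonal P D μ) (hT : IsUTGRM P T v) (w : List (Letter × Expo)) :
    Integrable (fun ω => normTrace (starWord (pair (D ω) (T ω)) w)) P := by
  simp_rw [pair_eq_fun]
  refine integrable_normTrace_starWord (fun l x y => ?_) w
  cases l
  · exact hD.hasMoments hR x y
  · exact hT.hasMoments x y

theorem tendsto_tau_word [IsProbabilityMeasure μ] (hR : ∀ᵐ z ∂μ, ‖z‖ ≤ R)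
    {D T : (n : ℕ) → Ω n → Matrix (Fin n) (Fin n) ℂ} (hD : ∀ n, IsIIDDiagonal (P n) (D n) μ)
    (hT : ∀ n, IsUTGRM (P n) (T n) (1 / (n : ℝ≥0)))
    (hDT : ∀ n, IndepMatrices (P n) (D n) (T n)) (w : List (Letter × Expo)) :
    Tendsto (fun n => tau (P n) fun ω => starWord (pair (D n ω) (T n ω)) w) atTop
      (𝓝 (limitWord μ w)) := by
  have hcomm : ∀ n, ∀ᵐ ω ∂P n, Commute (D n ω) (star (D n ω)) := fun n => by
    filter_upwards [(hD n).ae_eq_diagonal] with ω hω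
    rw [hω, Matrix.star_eq_conjTranspose, Matrix.diagonal_conjTranspose]
    exact Matrix.commute_diagonal _ _
  rw [limitWord]
  split_ifs with hw
  · refine tendsto_const_nhds.congr' ?_
    filter_upwards [eventually_gt_atTop 0] with n hn
    rw [← tau_diagonal_word hn hR (hD n), tau, tau]
    refine integral_congr_ae ?_
    filter_upwards [hcomm n] with ω hω
    rw [normTrace, normTrace, trace_starWord_of_nil hω _ hw]
  · have hlen : 0 < (cyclicBlocks (parse w)).length := by
      rcases hp : parse w with ⟨_ | ⟨b, L⟩, t⟩
      · exact absurd (by rw [hp]) hw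
      · simp [cyclicBlocks]
    refine (tendsto_sum_labelSum hR hlen _ _ _).congr' ?_
    -- At n = 0 the variance `1 / n` is 0 by convention; Wick's formula needs it nonzero.
    filter_upwards [eventually_gt_atTop 0] with n hn
    have hv : (1 / (n : ℝ≥0)) ≠ 0 := by positivity
    rw [← tau_word_eq hv hlen hR (hD n) (hT n) (hDT n), tau, tau]
    refine integral_congr_ae ?_
    filter_upwards [hcomm n] with ω hω
    rw [normTrace, normTrace, trace_starWord_of_ne_nil hω _ hw, blockProd_eq_prod_ofFn]

/-- A deterministic identity matrix is independent of `T`, so the moments of `T` alone become a case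
of the joint theorem on the same probability space. -/
lemma isIIDDiagonal_one {Ω : Type*} [MeasurableSpace Ω] (P : Measure Ω) [IsProbabilityMeasure P]
    (n : ℕ) : IsIIDDiagonal P (fun _ => (1 : Matrix (Fin n) (Fin n) ℂ)) (Measure.dirac 1) where
  off_diag i j h := Eventually.of_forall fun _ => Matrix.one_apply_ne h
  law i := ⟨by fun_prop, by simp [Measure.map_const]⟩
  indep := by
    simp only [Matrix.one_apply_eq]
    rw [iIndepFun_iff_map_fun_eq_pi_map fun _ => aemeasurable_const]
    simp only [Measure.map_const, measure_univ, one_smul]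
    rw [← Measure.infinitePi_eq_pi, Measure.infinitePi_dirac]

lemma limitDT_dirac_one {k : ℕ} (ε : Fin k → Expo) :
    limitDT (Measure.dirac 1) (fun _ => 0) (fun _ => 0) ε = limitT ε := by
  simp [limitDT, limitT, weight, starMoment]

lemma starWord_wordT {A : Type*} [Monoid A] [Star A] {k : ℕ} (T : A) (ε : Fin k → Expo) :
    starWord (fun _ => T) (wordT ε) = starWord (pair 1 T) (wordDT (fun _ => 0) (fun _ => 0) ε) := by
  simp [starWord, wordT, wordDT, wordD, List.map_ofFn, List.map_flatten, Function.comp_def, pair]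

theorem tendsto_tau_wordT {T : (n : ℕ) → Ω n → Matrix (Fin n) (Fin n) ℂ}
    (hT : ∀ n, IsUTGRM (P n) (T n) (1 / (n : ℝ≥0))) {k : ℕ} (hk : 1 ≤ k) (ε : Fin k → Expo) :
    Tendsto (fun n => tau (P n) fun ω => starWord (fun _ => T n ω) (wordT ε)) atTop
      (𝓝 (limitT ε)) := by
  have h := tendsto_tau_word (P := P) (μ := Measure.dirac 1) (R := 1)
    ((ae_dirac_iff (by measurability)).2 (by simp)) (fun n => isIIDDiagonal_one (P n) n) hT
    (fun n => indepFun_const_left _ _) (wordDT (fun _ => 0) (fun _ => 0) ε)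
  rw [limitWord_wordDT _ hk, limitDT_dirac_one] at h
  simpa only [starWord_wordT] using h

end Convergence

lemma exists_ae_bound_of_isCompact_support {μ : Measure ℂ} (h : IsCompact μ.support) :
    ∃ R : ℝ, ∀ᵐ z ∂μ, ‖z‖ ≤ R := by
  obtain ⟨R, hR⟩ := h.isBounded.exists_norm_le
  refine ⟨R, ?_⟩
  filter_upwards [Measure.support_mem_ae] with z hz
  exact hR z hz

lemma limitT_eq_zero {k : ℕ} {ε : Fin k → Expo}
    (h : ¬ ∃ σ, IsPairing σ ∧ IsNonCrossing σ ∧ IsCompatible ε σ) : limitT ε = 0 := by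
  have : compatibleNCP ε = ∅ := by
    classical
    rw [compatibleNCP, Finset.filter_eq_empty_iff]
    exact fun σ _ hσ => h ⟨σ, hσ⟩
  simp [limitT, this]

end DT

theorem mainTheorem5 :
    -- the pair converges jointly in star-moments, with the stated limit
    (∀ (μ : Measure ℂ) [IsProbabilityMeasure μ], IsCompact μ.support →
      ∃ φ : List (DT.Letter × DT.Expo) → ℂ,
        (∀ (Ω : ℕ → Type*) [∀ n, MeasurableSpace (Ω n)]
          (P : (n : ℕ) → Measure (Ω n)) [∀ n, IsProbabilityMeasure (P n)]
          (D T : (n : ℕ) → Ω n → Matrix (Fin n) (Fin n) ℂ),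
          (∀ n, DT.IsIIDDiagonal (P n) (D n) μ) →
          (∀ n, DT.IsUTGRM (P n) (T n) (1 / (n : ℝ≥0))) →
          (∀ n, DT.IndepMatrices (P n) (D n) (T n)) →
          ∀ w : List (DT.Letter × DT.Expo),
            (∀ n, Integrable
              (fun ω => DT.normTrace (DT.starWord (DT.pair (D n ω) (T n ω)) w)) (P n)) ∧
            Tendsto (fun n => DT.tau (P n) fun ω => DT.starWord (DT.pair (D n ω) (T n ω)) w)
              atTop (𝓝 (φ w))) ∧
        (∀ a b : ℕ, φ (DT.wordD a b) = DT.starMoment μ a b) ∧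
        (∀ (k : ℕ), 1 ≤ k → ∀ (a b : Fin k → ℕ) (ε : Fin k → DT.Expo),
          φ (DT.wordDT a b ε) = DT.limitDT μ a b ε)) ∧
    -- the star-moments of the triangular part alone
    (∀ (Ω : ℕ → Type*) [∀ n, MeasurableSpace (Ω n)]
      (P : (n : ℕ) → Measure (Ω n)) [∀ n, IsProbabilityMeasure (P n)]
      (T : (n : ℕ) → Ω n → Matrix (Fin n) (Fin n) ℂ),
      (∀ n, DT.IsUTGRM (P n) (T n) (1 / (n : ℝ≥0))) →
      ∀ (k : ℕ), 1 ≤ k → ∀ ε : Fin k → DT.Expo,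
        (∀ n, Integrable
          (fun ω => DT.normTrace (DT.starWord (fun _ => T n ω) (DT.wordT ε))) (P n)) ∧
        Tendsto (fun n => DT.tau (P n) fun ω => DT.starWord (fun _ => T n ω) (DT.wordT ε))
          atTop (𝓝 (DT.limitT ε)) ∧
        ((¬ ∃ σ, DT.IsPairing σ ∧ DT.IsNonCrossing σ ∧ DT.IsCompatible ε σ) →
          Tendsto (fun n => DT.tau (P n) fun ω => DT.starWord (fun _ => T n ω) (DT.wordT ε))
            atTop (𝓝 0))) ∧
    -- the counts of total orderings are positive
    (∀ (k : ℕ), 1 ≤ k → ∀ (ε : Fin k → DT.Expo) (σ : Fin k → Fin k),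
      DT.IsPairing σ → DT.IsNonCrossing σ → DT.IsCompatible ε σ → 1 ≤ DT.NTO ε σ) := by
  -- The limit functional is fixed before the probability spaces and matrices, so it depends on μ
  -- and the word only.
  refine ⟨fun μ _ hμ => ⟨DT.limitWord μ, fun Ω _ P _ D T hD hT hDT w => ?_,
    DT.limitWord_wordD μ, fun k hk a b ε => DT.limitWord_wordDT μ hk a b ε⟩,
    fun Ω _ P _ T hT k hk ε => ⟨fun n => ?_, DT.tendsto_tau_wordT hT hk ε, fun h => ?_⟩,
    fun k _ ε σ h₁ h₂ h₃ => DT.NTO_pos h₁ h₂ h₃⟩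
  · obtain ⟨R, hR⟩ := DT.exists_ae_bound_of_isCompact_support hμ
    exact ⟨fun n => DT.integrable_word hR (hD n) (hT n) w, DT.tendsto_tau_word hR hD hT hDT w⟩
  · exact DT.integrable_normTrace_starWord (X := fun _ : Unit => T n)
      (fun _ x y => (hT n).hasMoments x y) _
  · rw [← DT.limitT_eq_zero h]
    exact DT.tendsto_tau_wordT hT hk ε
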